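/- A plane graph is a finite simple graph $G$ drawn in the Euclidean plane: its vertices are distinct points, every edge $uv$ is a simple polygonal arc joining $u$ and $v$, an edge contains no vertex other than its two ends, and two distinct edges meet at most in a common end. The faces of $G$ are the connected components of the complement of the drawing in the plane (including the unbounded one, the outer face). A plane graph $G$ is a plane triangulation if the boundary of every face, including the outer face, consists of the three edges of a triangle of $G$. Let $G$ be a plane triangulation. Then $G$ is regular (all its vertices have the same degree) if and only if, as an abstract graph, $G$ is isomorphic to one of $K_3$, $K_4$, the octahedron graph $R_1=K_{2,2,2}$, and the icosahedron graph $R_6$. Here $R_6$ is the graph on $12$ vertices $x, x_0,\dots,x_4, y, y_0,\dots,y_4$ (indices modulo $5$) whose $30$ edges are $xx_i$, $x_ix_{i+1}$, $yy_i$, $y_iy_{i+1}$, $x_iy_i$ and $x_iy_{i+1}$ for $i=0,\dots,4$. -/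

import Mathlib

/-- The Euclidean plane. -/
abbrev Plane : Type := EuclideanSpace ℝ (Fin 2)

/-- `A` is a (simple) polygonal arc with end points `p` and `q`: a union of `m ≥ 1` nondegenerate
segments `[c 0, c 1], [c 1, c 2], …, [c (m - 1), c m]`, where `c 0 = p` and `c m = q`, such that
consecutive segments meet in their common end point only and other segments do not meet.
(The values `c i` with `i > m` are irrelevant.) -/
def IsPolygonalArc (A : Set Plane) (p q : Plane) : Prop :=
  ∃ (m : ℕ) (c : ℕ → Plane),
    0 < m ∧ c 0 = p ∧ c m = q ∧
    (∀ i < m, c i ≠ c (i + 1)) ∧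
    (∀ i j, i < j → j < m →
      segment ℝ (c i) (c (i + 1)) ∩ segment ℝ (c j) (c (j + 1)) =
        if j = i + 1 then {c j} else ∅) ∧
    A = ⋃ i ∈ Set.Iio m, segment ℝ (c i) (c (i + 1))

/-- A plane graph with underlying (abstract) graph `G`, that is, a drawing of `G` in the plane:
vertices are distinct points, an edge `uv` is a polygonal arc between the points of `u` and `v`,
an edge contains no vertex besides its two ends, and two different edges have no common point
besides a common end vertex. (The values of `arc` outside the edge set of `G` are irrelevant.) -/
structure PlaneDrawing {V : Type*} (G : SimpleGraph V) where
  point : V → Plane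
  point_injective : Function.Injective point
  arc : Sym2 V → Set Plane
  isPolygonalArc : ∀ u v, G.Adj u v → IsPolygonalArc (arc s(u, v)) (point u) (point v)
  mem_of_point_mem : ∀ e ∈ G.edgeSet, ∀ w, point w ∈ arc e → w ∈ e
  inter_subset : ∀ e ∈ G.edgeSet, ∀ e' ∈ G.edgeSet, e ≠ e' →
    arc e ∩ arc e' ⊆ point '' {w | w ∈ e ∧ w ∈ e'}

namespace PlaneDrawing

variable {V : Type*} {G : SimpleGraph V}

/-- The point set of a plane graph: all its vertices and edges. -/
def support (D : PlaneDrawing G) : Set Plane :=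
  Set.range D.point ∪ ⋃ e ∈ G.edgeSet, D.arc e

/-- A face is a connected component of the complement of the plane graph
(the unbounded component, i.e. the outer face, included). -/
def IsFace (D : PlaneDrawing G) (F : Set Plane) : Prop :=
  ∃ x ∈ D.supportᶜ, F = connectedComponentIn D.supportᶜ x

/-- A `3`-face: a face whose boundary is (the drawing of) a triangle of `G`. -/
def IsThreeFace (D : PlaneDrawing G) (F : Set Plane) : Prop :=
  D.IsFace F ∧ ∃ a b c : V, G.Adj a b ∧ G.Adj b c ∧ G.Adj c a ∧
    frontier F = D.arc s(a, b) ∪ D.arc s(b, c) ∪ D.arc s(c, a)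

/-- A plane triangulation: every face, the outer face included, is a `3`-face. -/
def IsTriangulation (D : PlaneDrawing G) : Prop :=
  ∀ F : Set Plane, D.IsFace F → D.IsThreeFace F

end PlaneDrawing

/-- The octahedron graph, i.e. the complete tripartite graph `K_{2,2,2}`. -/
abbrev octahedronGraph : SimpleGraph (Fin 3 × Fin 2) :=
  SimpleGraph.completeEquipartiteGraph 3 2

/-- The icosahedron graph. For each `s : Bool` there is an apex `(s, none)` adjacent to all the
vertices of the pentagon `(s, some 0), …, (s, some 4)`, and the two pentagons are joined
by the zigzag in which `(false, some i)` is adjacent to `(true, some i)` and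
`(true, some (i + 1))`. -/
def icosahedronGraph : SimpleGraph (Bool × Option (ZMod 5)) :=
  SimpleGraph.fromRel fun x y =>
    match x, y with
    | (s, none), (t, some _) => s = t
    | (false, some i), (false, some j) => j = i + 1
    | (true, some i), (true, some j) => j = i + 1
    | (false, some i), (true, some j) => j = i ∨ j = i + 1
    | _, _ => False

/-! Two facts about plane triangulations carry the proof: Euler's inequality E + 2 ≤ F + V, and the
fact that the two sides of an edge are different faces. Neither uses the Jordan curve theorem; both
come from a logarithmic potential. For an edge drawn as a chain of segments, sum the principal
logarithms log((b - p)/(a - p)) over its segments [a, b]. The derivative in p telescopes to a term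
depending only on the two ends, and the value jumps by 2πi across the first segment. For a cycle z
of the graph, the combination of these sums with weights z(e) has derivative zero off the drawing,
so it is constant on every face and jumps by 2πi·z(e) across e.

If both sides of e were one face, every cycle would vanish on e; the triangle bounding that face
does not. Moreover, cycles together with constants inject into functions on the faces, which gives
Euler's inequality by counting dimensions. With 3F ≤ 2E this yields E + 6 ≤ 3V, so a regular
triangulation has degree k ≤ 5, and k ≥ 2 because faces are triangles.

For k = 2 the triangle of a face is the whole graph. For k ≥ 3 every edge lies in exactly two facial
triangles (`IsTriangleSystem`), and the rest is combinatorial. The link of a vertex is 2-regular on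
k ≤ 5 vertices, hence a single cycle, since two disjoint cycles need six vertices. Growing the
triangles outwards from one vertex produces an injective homomorphism from the candidate graph, and
regularity with connectedness makes it an isomorphism (`nonempty_iso_of_injective_hom`). Local data
alone also allow K₆, as it triangulates the projective plane; the bound on E rules it out. -/

open SimpleGraph Filter Topology

/-! ### Regular graphs and abstract triangle systems. -/

namespace SimpleGraph

variable {V W : Type*} {G : SimpleGraph V}

theorem Preconnected.mem_of_adj_closed (hG : G.Preconnected) {S : Set V} {v : V} (hv : v ∈ S)
    (hS : ∀ x ∈ S, ∀ y, G.Adj x y → y ∈ S) (w : V) : w ∈ S := by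
  obtain ⟨p⟩ := hG v w
  induction p with
  | nil => exact hv
  | cons h p ih => exact ih (hS _ hv _ h)

theorem IsRegularOfDegree.of_iso [Fintype V] [DecidableRel G.Adj] [Fintype W] {H : SimpleGraph W}
    [DecidableRel H.Adj] {k : ℕ} (hH : H.IsRegularOfDegree k) (f : G ≃g H) :
    G.IsRegularOfDegree k := fun v => by
  rw [← f.degree_eq v]; exact hH (f v)

/-- An injective homomorphism from a nonempty `k`-regular graph to a connected `k`-regular graph
is an isomorphism. -/
theorem nonempty_iso_of_injective_hom [Fintype V] [DecidableRel G.Adj] (hG : G.Preconnected)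
    {k : ℕ} (hk : G.IsRegularOfDegree k) [Fintype W] [Nonempty W] {H : SimpleGraph W}
    [DecidableRel H.Adj] (hH : H.IsRegularOfDegree k) (f : W → V) (hf : Function.Injective f)
    (hadj : ∀ x y, H.Adj x y → G.Adj (f x) (f y)) : Nonempty (G ≃g H) := by
  classical
  -- Both degrees are `k`, so `f` maps neighbourhoods onto neighbourhoods. Hence its range is closed
  -- under adjacency, and `f` also reflects edges.
  have key : ∀ x v, G.Adj (f x) v → ∃ y, H.Adj x y ∧ f y = v := by
    intro x v hv
    have hsub : (H.neighborFinset x).image f ⊆ G.neighborFinset (f x) := by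
      intro u hu
      obtain ⟨y, hy, rfl⟩ := Finset.mem_image.1 hu
      exact (G.mem_neighborFinset _ _).2 (hadj _ _ ((H.mem_neighborFinset _ _).1 hy))
    have heq := Finset.eq_of_subset_of_card_le hsub (by
      rw [Finset.card_image_of_injective _ hf, card_neighborFinset_eq_degree,
        card_neighborFinset_eq_degree, hk, hH])
    have : v ∈ (H.neighborFinset x).image f := by
      rw [heq]; exact (G.mem_neighborFinset _ _).2 hv
    obtain ⟨y, hy, rfl⟩ := Finset.mem_image.1 this
    exact ⟨y, (H.mem_neighborFinset _ _).1 hy, rfl⟩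
  have hsurj : Function.Surjective f := by
    intro v
    refine hG.mem_of_adj_closed (S := Set.range f) ⟨Classical.arbitrary W, rfl⟩ ?_ v
    rintro _ ⟨x, rfl⟩ y hy
    obtain ⟨z, -, rfl⟩ := key x y hy
    exact ⟨z, rfl⟩
  refine ⟨(RelIso.mk (Equiv.ofBijective f ⟨hf, hsurj⟩) ?_ : H ≃g G).symm⟩
  intro x y
  refine ⟨fun h => ?_, hadj x y⟩
  obtain ⟨z, hz, hzy⟩ := key x _ h
  rwa [← hf hzy]

theorem neighborFinset_eq_of_subset [Fintype V] [DecidableRel G.Adj] {k : ℕ}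
    (hk : G.IsRegularOfDegree k) {v : V} {s : Finset V} (hs : ∀ x ∈ s, G.Adj v x)
    (hcard : k ≤ s.card) : ∀ x, G.Adj v x ↔ x ∈ s := by
  have h := Finset.eq_of_subset_of_card_le (s := s) (t := G.neighborFinset v)
    (fun x hx => (G.mem_neighborFinset _ _).2 (hs x hx))
    (by rwa [card_neighborFinset_eq_degree, hk])
  intro x
  rw [h, mem_neighborFinset]

/-- A family of triangles of `G` such that each edge lies in exactly two of them. -/
structure IsTriangleSystem (G : SimpleGraph V) (T : V → V → V → Prop) : Prop where
  adj : ∀ {a b c}, T a b c → G.Adj a b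
  swap : ∀ {a b c}, T a b c → T b a c
  rot : ∀ {a b c}, T a b c → T b c a
  exists_two : ∀ {a b}, G.Adj a b →
    ∃ c d, c ≠ d ∧ T a b c ∧ T a b d ∧ ∀ x, T a b x → x = c ∨ x = d

namespace IsTriangleSystem

variable {T : V → V → V → Prop} (hT : G.IsTriangleSystem T)
include hT

theorem swap' {a b c : V} (h : T a b c) : T a c b := hT.swap (hT.rot (hT.rot h))

theorem adj' {a b c : V} (h : T a b c) : G.Adj a c := hT.adj (hT.swap' h)

theorem exists_other {a b c : V} (h : T a b c) : ∃ d, d ≠ c ∧ T a b d := by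
  obtain ⟨x, y, hxy, hx, hy, -⟩ := hT.exists_two (hT.adj h)
  by_cases hxc : x = c
  · exact ⟨y, fun h => hxy (hxc.trans h.symm), hy⟩
  · exact ⟨x, hxc, hx⟩

theorem eq_or_eq {a b c d x : V} (hc : T a b c) (hd : T a b d) (hcd : c ≠ d) (hx : T a b x) :
    x = c ∨ x = d := by
  obtain ⟨y, z, -, -, -, h⟩ := hT.exists_two (hT.adj hc)
  have h1 := h _ hc
  have h2 := h _ hd
  have h3 := h _ hx
  grind

theorem third {a b c d x : V} (hc : T a b c) (hd : T a b d) (hx : T a b x) (hcd : c ≠ d)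
    (hxc : x ≠ c) : x = d :=
  (hT.eq_or_eq hc hd hcd hx).resolve_left hxc

theorem ne {a b c : V} (h : T a b c) : a ≠ b ∧ b ≠ c ∧ a ≠ c :=
  ⟨(hT.adj h).ne, (hT.adj (hT.rot h)).ne, (hT.adj' h).ne⟩

end IsTriangleSystem

end SimpleGraph

/-! ### Triangle systems of degree three, four and five. -/

/-- The graph is `K₄` when every vertex has degree `3`. -/
theorem SimpleGraph.IsTriangleSystem.iso_top_four {V : Type*} [Fintype V] {G : SimpleGraph V}
    [DecidableRel G.Adj] {T : V → V → V → Prop} (hT : G.IsTriangleSystem T) (hG : G.Preconnected)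
    (hk : G.IsRegularOfDegree 3) (hV : Nonempty V) :
    Nonempty (G ≃g (⊤ : SimpleGraph (Fin 4))) := by
  classical
  obtain ⟨v⟩ := hV
  obtain ⟨a, ha⟩ : ∃ a, G.Adj v a := by
    have : 0 < G.degree v := by rw [hk v]; norm_num
    exact (G.degree_pos_iff_exists_adj v).1 this
  obtain ⟨b, c, hbc, hb, hc, -⟩ := hT.exists_two ha
  have hN := neighborFinset_eq_of_subset hk (v := v) (s := {a, b, c})
    (by
      intro x hx
      simp only [Finset.mem_insert, Finset.mem_singleton] at hx
      rcases hx with rfl | rfl | rfl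
      exacts [ha, hT.adj' hb, hT.adj' hc])
    (by
      have := hT.ne hb
      have := hT.ne hc
      rw [Finset.card_eq_three.2 ⟨a, b, c, by grind, by grind, by grind, rfl⟩])
  simp only [Finset.mem_insert, Finset.mem_singleton] at hN
  have hbc' : T v b c := by
    obtain ⟨d, hd, hd'⟩ := hT.exists_other (hT.swap' hb)
    have h1 := (hN d).1 (hT.adj' hd')
    have := hT.ne hd'
    rcases h1 with rfl | rfl | rfl
    · exact absurd rfl hd
    · grind
    · exact hd'
  have nb := hT.ne hb
  have nc := hT.ne hc
  have e1 := hT.adj (hT.rot hb)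
  have e2 := hT.adj (hT.rot hc)
  have e3 := hT.adj (hT.rot hbc')
  have hvb := hT.adj' hb
  have hvc := hT.adj' hc
  refine nonempty_iso_of_injective_hom hG hk (H := (⊤ : SimpleGraph (Fin 4)))
    (by have := IsRegularOfDegree.top (V := Fin 4); simpa using this) ![v, a, b, c] ?_ ?_
  · intro i j hij
    fin_cases i <;> fin_cases j <;> simp at hij ⊢ <;> grind
  · intro i j hij
    fin_cases i <;> fin_cases j <;> simp at hij ⊢ <;>
      first | assumption | (apply SimpleGraph.Adj.symm; assumption)

theorem octahedronGraph_isRegularOfDegree : octahedronGraph.IsRegularOfDegree 4 := by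
  intro v
  revert v
  decide

/-- The graph is the octahedron when every vertex has degree `4`. -/
theorem SimpleGraph.IsTriangleSystem.iso_octahedronGraph {V : Type*} [Fintype V]
    {G : SimpleGraph V} [DecidableRel G.Adj] {T : V → V → V → Prop} (hT : G.IsTriangleSystem T)
    (hG : G.Preconnected) (hk : G.IsRegularOfDegree 4) (hV : Nonempty V) :
    Nonempty (G ≃g octahedronGraph) := by
  classical
  -- The path b, a, c in the link of `v` closes to a 4-cycle through a new vertex `d`. If the link
  -- closed up after three vertices, the fourth neighbour would have no link neighbours left.
  have cyc : ∀ {v a b c}, T v a b → T v a c → b ≠ c → ∃ d, d ≠ a ∧ d ≠ b ∧ d ≠ c ∧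
      T v b d ∧ T v c d ∧ ∀ x, G.Adj v x ↔ x = a ∨ x = b ∨ x = c ∨ x = d := by
    intro v a b c hb hc hbc
    have nb := hT.ne hb
    have nc := hT.ne hc
    obtain ⟨d, hda, hd⟩ := hT.exists_other (hT.swap' hb)
    have nd := hT.ne hd
    by_cases hdc : d = c
    · subst hdc
      exfalso
      have : ∃ e, e ∈ G.neighborFinset v \ {a, b, d} := by
        apply Finset.card_pos.1
        have h1 := Finset.le_card_sdiff {a, b, d} (G.neighborFinset v)
        have h2 : (Finset.card {a, b, d}) ≤ 3 := Finset.card_le_three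
        rw [card_neighborFinset_eq_degree, hk v] at h1
        omega
      obtain ⟨e, he⟩ := this
      simp only [Finset.mem_sdiff, mem_neighborFinset, Finset.mem_insert, Finset.mem_singleton,
        not_or] at he
      have hN := neighborFinset_eq_of_subset hk (v := v) (s := {a, b, d, e})
        (by
          intro x hx
          simp only [Finset.mem_insert, Finset.mem_singleton] at hx
          rcases hx with rfl | rfl | rfl | rfl
          exacts [hT.adj hb, hT.adj' hb, hT.adj' hc, he.1])
        (by
          rw [Finset.card_insert_of_notMem (by simp; grind), Finset.card_eq_three.2
            ⟨b, d, e, by grind, by grind, by grind, rfl⟩])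
      simp only [Finset.mem_insert, Finset.mem_singleton] at hN
      obtain ⟨f, g, hfg, hf, hg, -⟩ := hT.exists_two he.1
      have := hT.ne hf
      have := hT.ne hg
      have hf' := (hN f).1 (hT.adj' hf)
      have hg' := (hN g).1 (hT.adj' hg)
      have s1 := fun h => hT.eq_or_eq hb hc (x := e) h
      have s2 := fun h => hT.eq_or_eq (hT.swap' hb) hd (x := e) h
      have s3 := fun h => hT.eq_or_eq (hT.swap' hc) (hT.swap' hd) (x := e) h
      have h3 := hT.swap' hf
      grind
    · have hN := neighborFinset_eq_of_subset hk (v := v) (s := {a, b, c, d})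
        (by
          intro x hx
          simp only [Finset.mem_insert, Finset.mem_singleton] at hx
          rcases hx with rfl | rfl | rfl | rfl
          exacts [hT.adj hb, hT.adj' hb, hT.adj' hc, hT.adj' hd])
        (by
          rw [Finset.card_insert_of_notMem (by simp; grind), Finset.card_eq_three.2
              ⟨b, c, d, by grind, by grind, by grind, rfl⟩])
      simp only [Finset.mem_insert, Finset.mem_singleton] at hN
      refine ⟨d, hda, nd.2.1.symm, hdc, hd, ?_, hN⟩
      obtain ⟨e, hea, he⟩ := hT.exists_other (hT.swap' hc)
      have ne := hT.ne he
      rcases (hN e).1 (hT.adj' he) with rfl | rfl | rfl | rfl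
      · exact absurd rfl hea
      · have := hT.eq_or_eq (hT.swap' hb) hd (by grind) (hT.swap' he)
        grind
      · grind
      · exact he
  obtain ⟨v⟩ := hV
  obtain ⟨a, ha⟩ : ∃ a, G.Adj v a := by
    have : 0 < G.degree v := by rw [hk v]; norm_num
    exact (G.degree_pos_iff_exists_adj v).1 this
  obtain ⟨b, d, hbd, hb, hd, -⟩ := hT.exists_two ha
  obtain ⟨c, hca, hcb, hcd, hbc, hdc, hN⟩ := cyc hb hd hbd
  obtain ⟨x, hxv, hxb, hxd, hbx, hdx, hNa⟩ := cyc (hT.swap hb) (hT.swap hd) hbd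
  obtain ⟨y, hyv, hya, hyc, hay, hcy, hNb⟩ := cyc (hT.swap (hT.swap' hb)) (hT.swap hbc) hca.symm
  have nb := hT.ne hb
  have nd := hT.ne hd
  have nbc := hT.ne hbc
  have ndc := hT.ne hdc
  have nbx := hT.ne hbx
  have ndx := hT.ne hdx
  -- Both are the apex, other than `v`, over the edge `ab`. This common vertex is the antipode of
  -- `v`.
  have hyx : y = x := by
    rcases hT.eq_or_eq (hT.swap (hT.rot hb)) (hT.swap hbx) hxv.symm hay with h | h
    · exact absurd h hyv
    · exact h
  subst hyx
  have hac : ¬ G.Adj a c := by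
    intro h
    have := (hNa c).1 h
    grind
  have e1 := hT.adj hb
  have e2 := hT.adj' hb
  have e3 := hT.adj hdc
  have e4 := hT.adj' hdc
  have e5 := hT.adj hbx
  have e6 := hT.adj hdx
  have e7 := hT.adj' hdx
  have e8 := hT.adj (hT.rot hbx)
  have e9 := hT.adj (hT.rot hdx)
  have e10 := hT.adj (hT.rot hbc)
  have e11 := hT.adj (hT.rot hdc)
  have e12 := hT.adj (hT.rot hcy)
  have hcy' := e12.ne
  refine nonempty_iso_of_injective_hom hG hk octahedronGraph_isRegularOfDegree
    (fun p => (![![v, y], ![a, c], ![b, d]] : Fin 3 → Fin 2 → V) p.1 p.2) ?_ ?_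
  · rintro ⟨i, i'⟩ ⟨j, j'⟩ hij
    fin_cases i <;> fin_cases j <;> fin_cases i' <;> fin_cases j' <;> simp at hij ⊢ <;> grind
  · rintro ⟨i, i'⟩ ⟨j, j'⟩ hij
    rw [completeEquipartiteGraph_adj] at hij
    fin_cases i <;> fin_cases j <;> fin_cases i' <;> fin_cases j' <;> simp at hij ⊢ <;>
      first | assumption | (apply SimpleGraph.Adj.symm; assumption)

/-- A symmetrised form without the inequality of `fromRel`: it makes adjacency decidable, so that
degrees can be computed by evaluation. -/
theorem icosahedronGraph_adj_iff (x y : Bool × Option (ZMod 5)) : icosahedronGraph.Adj x y ↔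
    match x, y with
    | (s, none), (t, some _) => s = t
    | (s, some _), (t, none) => s = t
    | (false, some i), (false, some j) => j = i + 1 ∨ i = j + 1
    | (true, some i), (true, some j) => j = i + 1 ∨ i = j + 1
    | (false, some i), (true, some j) => j = i ∨ j = i + 1
    | (true, some i), (false, some j) => i = j ∨ i = j + 1
    | _, _ => False := by
  have h1 : ∀ i : ZMod 5, i ≠ i + 1 := by decide
  rcases x with ⟨_ | _, _ | i⟩ <;> rcases y with ⟨_ | _, _ | j⟩ <;>
    simp [icosahedronGraph, SimpleGraph.fromRel_adj, eq_comm] <;> grind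

instance icosahedronGraph.decidableRelAdj : DecidableRel icosahedronGraph.Adj := fun x y => by
  refine @decidable_of_iff' _ _ (icosahedronGraph_adj_iff x y) ?_
  rcases x with ⟨_ | _, _ | i⟩ <;> rcases y with ⟨_ | _, _ | j⟩ <;> dsimp only <;> infer_instance

theorem icosahedronGraph_isRegularOfDegree : icosahedronGraph.IsRegularOfDegree 5 := by
  intro v
  revert v
  decide +kernel

namespace SimpleGraph.IsTriangleSystem

variable {V : Type*} [Fintype V] {G : SimpleGraph V} [DecidableRel G.Adj] {T : V → V → V → Prop}
  (hT : G.IsTriangleSystem T)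
include hT

/-- In degree `5`, a path with three vertices in the link of a vertex closes up to a pentagon. -/
theorem exists_pentagon (hk : G.IsRegularOfDegree 5) {v a b c : V} (hab : T v a b)
    (hbc : T v b c) (hac : a ≠ c) :
    ∃ d e, T v c d ∧ T v d e ∧ T v e a ∧ [v, a, b, c, d, e].Nodup ∧
      ∀ x, G.Adj v x ↔ x = a ∨ x = b ∨ x = c ∨ x = d ∨ x = e := by
  classical
  have nab := hT.ne hab
  have nbc := hT.ne hbc
  have large : ∀ s : Finset V, s.card < 5 → ∃ e, G.Adj v e ∧ e ∉ s := by
    intro s hs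
    obtain ⟨e, he, hes⟩ := Finset.exists_mem_notMem_of_card_lt_card
      (s := s) (t := G.neighborFinset v) (by rw [card_neighborFinset_eq_degree, hk v]; exact hs)
    exact ⟨e, (G.mem_neighborFinset _ _).1 he, hes⟩
  have full : ∀ a b c d e, G.Adj v a → G.Adj v b → G.Adj v c → G.Adj v d → G.Adj v e →
      [a, b, c, d, e].Nodup →
      ∀ x, G.Adj v x ↔ x = a ∨ x = b ∨ x = c ∨ x = d ∨ x = e := by
    intro a b c d e ha hb hc hd he hn
    have hN := neighborFinset_eq_of_subset hk (v := v) (s := [a, b, c, d, e].toFinset)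
      (by
        intro x hx
        simp only [List.mem_toFinset, List.mem_cons, List.not_mem_nil, or_false] at hx
        rcases hx with rfl | rfl | rfl | rfl | rfl <;> assumption)
      (by rw [List.toFinset_card_of_nodup hn]; rfl)
    simpa using hN
  have sb := fun x (h : T v b x) => hT.eq_or_eq (hT.swap' hab) hbc hac h
  obtain ⟨d, hdb, hcd⟩ := hT.exists_other (hT.swap' hbc)
  have ncd := hT.ne hcd
  have sc := fun x (h : T v c x) => hT.eq_or_eq (hT.swap' hbc) hcd hdb.symm h
  -- Otherwise the link contains a closed triangle, and each of the two remaining neighbours could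
  -- only be linked to the other, though it needs two link neighbours.
  have hda : d ≠ a := by
    rintro rfl
    obtain ⟨e, he, hes⟩ := large {d, b, c} (Finset.card_le_three.trans_lt (by norm_num))
    obtain ⟨f, hf, hfs⟩ := large {d, b, c, e} (Finset.card_le_four.trans_lt (by norm_num))
    simp only [Finset.mem_insert, Finset.mem_singleton, not_or] at hes hfs
    have hN := full d b c e f (hT.adj hab) (hT.adj' hab) (hT.adj hcd) he hf (by simp; grind)
    obtain ⟨g, h, hgh, hg, hh, -⟩ := hT.exists_two he
    have sd := fun x (h : T v d x) => hT.eq_or_eq hab (hT.swap' hcd) nbc.2.1 h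
    have hg' := (hN g).1 (hT.adj' hg)
    have hh' := (hN h).1 (hT.adj' hh)
    have ng := hT.ne hg
    have nh := hT.ne hh
    have g' := hT.swap' hg
    have h' := hT.swap' hh
    clear full large hN
    grind
  obtain ⟨e, hec, hde⟩ := hT.exists_other (hT.swap' hcd)
  have nde := hT.ne hde
  have sd := fun x (h : T v d x) => hT.eq_or_eq (hT.swap' hcd) hde hec.symm h
  have heb : e ≠ b := by
    rintro rfl
    have := sb _ (hT.swap' hde)
    grind
  -- Otherwise four neighbours form a closed quadrilateral and the fifth has no link neighbours.
  have hea : e ≠ a := by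
    rintro rfl
    obtain ⟨f, hf, hfs⟩ := large {e, b, c, d} (Finset.card_le_four.trans_lt (by norm_num))
    simp only [Finset.mem_insert, Finset.mem_singleton, not_or] at hfs
    have hN := full e b c d f (hT.adj hab) (hT.adj' hab) (hT.adj hcd) (hT.adj hde) hf
      (by simp; grind)
    obtain ⟨g, -, -, hg, -⟩ := hT.exists_two hf
    have se := fun x (h : T v e x) => hT.eq_or_eq hab (hT.swap' hde) hdb.symm h
    have hg' := (hN g).1 (hT.adj' hg)
    have ng := hT.ne hg
    have g' := hT.swap' hg
    clear full large hN
    grind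
  have hN := full a b c d e (hT.adj hab) (hT.adj' hab) (hT.adj hcd) (hT.adj hde) (hT.adj' hde)
    (by simp; grind)
  refine ⟨d, e, hcd, hde, ?_, by simp; grind, hN⟩
  obtain ⟨f, hfd, hef⟩ := hT.exists_other (hT.swap' hde)
  have nf := hT.ne hef
  have hf' := (hN f).1 (hT.adj' hef)
  have f' := hT.swap' hef
  clear full large hN
  grind

/-- The vertices around a vertex of degree `5`, together with the outer apices over the sides of
the pentagon they form. -/
theorem exists_double_pentagon (hk : G.IsRegularOfDegree 5) (v : V) :
    ∃ x y : ZMod 5 → V, Function.Injective x ∧ (∀ i, T v (x i) (x (i + 1))) ∧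
      (∀ i, T (x i) (x (i + 1)) (y i)) ∧ (∀ i, T (x (i + 1)) (y (i + 1)) (y i)) ∧
      (∀ i, [x (i + 1), x i, v, x (i + 2), y (i + 1), y i].Nodup) ∧
      (∀ w, G.Adj v w → ∃ i, w = x i) ∧
      ∀ i w, G.Adj (x (i + 1)) w ↔
        w = x i ∨ w = v ∨ w = x (i + 2) ∨ w = y (i + 1) ∨ w = y i := by
  obtain ⟨x, hinj, hx, hN⟩ : ∃ x : ZMod 5 → V, Function.Injective x ∧
      (∀ i, T v (x i) (x (i + 1))) ∧ ∀ w, G.Adj v w → ∃ i, w = x i := by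
    obtain ⟨a, ha⟩ : ∃ a, G.Adj v a := by
      have : 0 < G.degree v := by rw [hk v]; norm_num
      exact (G.degree_pos_iff_exists_adj v).1 this
    obtain ⟨b, c, hbc, hb, hc, -⟩ := hT.exists_two ha
    obtain ⟨d, e, h1, h2, h3, hn, hN⟩ := hT.exists_pentagon hk (hT.swap' hb) hc hbc
    refine ⟨(![b, a, c, d, e] : Fin 5 → V), ?_, ?_, ?_⟩
    · intro i j
      change Fin 5 at i j
      simp at hn
      fin_cases i <;> fin_cases j <;> simp <;> grind
    · intro i
      change Fin 5 at i
      fin_cases i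
      exacts [hT.swap' hb, hc, h1, h2, h3]
    · intro w hw
      rcases (hN w).1 hw with rfl | rfl | rfl | rfl | rfl
      exacts [⟨(0 : Fin 5), rfl⟩, ⟨(1 : Fin 5), rfl⟩, ⟨(2 : Fin 5), rfl⟩, ⟨(3 : Fin 5), rfl⟩,
        ⟨(4 : Fin 5), rfl⟩]
  choose y hyv hy using fun i => hT.exists_other (hT.rot (hx i))
  -- The link of `x (i + 1)` contains the path `x i`, `v`, `x (i + 2)`; its other two vertices must
  -- be the outer apices `y (i + 1)` and `y i`.
  have main : ∀ i, T (x (i + 1)) (y (i + 1)) (y i) ∧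
      [x (i + 1), x i, v, x (i + 2), y (i + 1), y i].Nodup ∧
      ∀ w, G.Adj (x (i + 1)) w ↔
        w = x i ∨ w = v ∨ w = x (i + 2) ∨ w = y (i + 1) ∨ w = y i := by
    intro i
    have e2 : i + 1 + 1 = i + 2 := by ring
    have t1 := hx (i + 1)
    have t2 := hy (i + 1)
    rw [e2] at t1 t2
    have hne : x i ≠ x (i + 2) := hinj.ne (by clear * -; revert i; decide)
    have p1 : T (x (i + 1)) (x i) v := hT.swap (hT.rot (hx i))
    have p2 : T (x (i + 1)) v (x (i + 2)) := hT.swap t1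
    obtain ⟨d, e, h1, h2, h3, hn, hN⟩ := hT.exists_pentagon hk p1 p2 hne
    have hn' := hn
    simp only [List.nodup_cons, List.mem_cons, List.not_mem_nil, or_false, not_or] at hn'
    have hd : d = y (i + 1) := hT.third (hT.swap' p2) t2 h1 (hyv _).symm (by grind)
    have he : e = y i := hT.third p1 (hT.swap (hy i)) (hT.swap' h3) (hyv _).symm (by grind)
    subst hd he
    exact ⟨h2, hn, hN⟩
  exact ⟨x, y, hinj, hx, hy, fun i => (main i).1, fun i => (main i).2.1, hN,
    fun i => (main i).2.2⟩

/-- Around `v` lie the pentagon `x`, then the ring of outer apices `y`, then a common apex `z`. The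
bound on the number of vertices excludes K₆ with its triangulation of the projective plane, in which
the ring `y` folds back onto `x`. -/
theorem iso_icosahedronGraph (hG : G.Preconnected) (hk : G.IsRegularOfDegree 5)
    (hV : Nonempty V) (hcard : 6 < Fintype.card V) : Nonempty (G ≃g icosahedronGraph) := by
  classical
  obtain ⟨v⟩ := hV
  obtain ⟨x, y, hinj, hx, hxy, hyy, hnd, hNv, hNx⟩ := hT.exists_double_pentagon hk v
  have hadd : ∀ i j : ZMod 5, j = i ∨ j = i + 1 ∨ j = i + 2 ∨ j = i + 3 ∨ j = i + 4 := by decide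
  have a11 : ∀ i : ZMod 5, i + 1 + 1 = i + 2 := by decide
  have a12 : ∀ i : ZMod 5, i + 1 + 2 = i + 3 := by decide
  have a21 : ∀ i : ZMod 5, i + 2 + 1 = i + 3 := by decide
  have a13 : ∀ i : ZMod 5, i + 1 + 3 = i + 4 := by decide
  have a31 : ∀ i : ZMod 5, i + 3 + 1 = i + 4 := by decide
  have a22 : ∀ i : ZMod 5, i + 2 + 2 = i + 4 := by decide
  have a41 : ∀ i : ZMod 5, i + 4 + 1 = i := by decide
  have a42 : ∀ i : ZMod 5, i + 4 + 2 = i + 1 := by decide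
  have hxne : ∀ i j : ZMod 5, i ≠ j → x i ≠ x j := fun i j h => hinj.ne h
  simp only [List.nodup_cons, List.mem_cons, List.not_mem_nil, or_false, not_or] at hnd
  -- Links already exclude every `j` but `i + 3`. One coincidence `y i = x (i + 3)` forces the same
  -- at `i + 2`, hence everywhere because 2 generates `ZMod 5`; then `v` and the `x i` are all the
  -- vertices, at most six.
  have hyx : ∀ i j, y i ≠ x j := by
    have step : ∀ i, y i = x (i + 3) → y (i + 2) = x (i + 2 + 3) := by
      intro i hi
      have h1 := hNx (i + 2)
      have hd := hnd (i + 2)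
      rw [a21, a22] at h1 hd
      have t := hxy i
      rw [hi] at t
      have e : i + 2 + 3 = i := by clear * -; revert i; decide
      rw [e]
      have := (h1 (x i)).1 (hT.adj (hT.rot (hT.rot t)))
      have h2 := (h1 (x (i + 1))).1 (hT.adj' (hT.rot (hT.rot t)))
      have d := hnd (i + 1)
      rw [a11, a12] at d
      have q1 := hxne i (i + 2) (by clear * -; revert i; decide)
      have q2 := hxne i (i + 4) (by clear * -; revert i; decide)
      have q3 := hxne (i + 1) (i + 2) (by clear * -; revert i; decide)
      have q4 := hxne (i + 1) (i + 4) (by clear * -; revert i; decide)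
      have q5 := hxne i (i + 1) (by clear * -; revert i; decide)
      have d' := hnd i
      grind
    have none : ∀ i, y i ≠ x (i + 3) := by
      intro i hi
      have all : ∀ j, y j = x (j + 3) := by
        have h2 := step _ hi
        have h4 := step _ h2
        have h6 := step _ h4
        have h8 := step _ h6
        have e4 : i + 2 + 2 = i + 4 := by ring
        have e6 : i + 2 + 2 + 2 = i + 1 := by clear * -; revert i; decide
        have e8 : i + 2 + 2 + 2 + 2 = i + 3 := by clear * -; revert i; decide
        rw [e8] at h8
        rw [e6] at h6
        rw [e4] at h4
        intro j
        rcases hadd i j with rfl | rfl | rfl | rfl | rfl <;> assumption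
      have hall : ∀ w, w ∈ insert v (Finset.univ.image x) := by
        intro w
        refine hG.mem_of_adj_closed (S := {w | w ∈ insert v (Finset.univ.image x)}) (v := v)
          (by simp) ?_ w
        intro a ha b hb
        simp only [Set.mem_ofPred_eq, Finset.mem_insert, Finset.mem_image, Finset.mem_univ,
          true_and] at ha ⊢
        rcases ha with rfl | ⟨j, rfl⟩
        · obtain ⟨i, rfl⟩ := hNv b hb
          exact Or.inr ⟨i, rfl⟩
        · rw [← a41 j, hNx (j + 4) b, all, all] at hb
          rcases hb with rfl | rfl | rfl | rfl | rfl
          exacts [Or.inr ⟨_, rfl⟩, Or.inl rfl, Or.inr ⟨_, rfl⟩, Or.inr ⟨_, rfl⟩, Or.inr ⟨_, rfl⟩]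
      have h1 : Fintype.card V ≤ (insert v (Finset.univ.image x)).card :=
        Finset.card_le_card fun w _ => hall w
      have h2 := Finset.card_insert_le v (Finset.univ.image x)
      have h3 : (Finset.univ.image x).card ≤ (Finset.univ : Finset (ZMod 5)).card :=
        Finset.card_image_le
      rw [Finset.card_univ, ZMod.card] at h3
      omega
    intro i j
    rcases hadd i j with rfl | rfl | rfl | rfl | rfl
    · have := hnd j; grind
    · have := hnd i; grind
    · have := hnd i; grind
    · exact none i
    · have := hnd (i + 4)
      rw [a41] at this
      grind
  have hyv : ∀ i, y i ≠ v := fun i => by have := hnd i; grind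
  have hyy1 : ∀ i, y (i + 1) ≠ y i := fun i => (hT.ne (hyy i)).2.1
  have hyinj : ∀ i j, y i = y j → i = j := by
    -- If equal, `y i` has the five neighbours listed below. Its neighbours `y (i + 4)` and `y (i +
    -- 3)` would then both be `y (i + 1)`, but they are adjacent to each other.
    have h2 : ∀ i, y (i + 2) ≠ y i := by
      intro i hi
      have hN := neighborFinset_eq_of_subset hk (v := y i)
        (s := [x i, x (i + 1), x (i + 2), x (i + 3), y (i + 1)].toFinset)
        (by
          intro w hw
          simp only [List.mem_toFinset, List.mem_cons, List.not_mem_nil, or_false] at hw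
          rcases hw with rfl | rfl | rfl | rfl | rfl
          · exact hT.adj (hT.rot (hT.rot (hxy i)))
          · exact hT.adj' (hT.rot (hT.rot (hxy i)))
          · have := hT.adj (hT.rot (hT.rot (hxy (i + 2)))); rwa [hi] at this
          · have := hT.adj' (hT.rot (hT.rot (hxy (i + 2)))); rwa [hi, a21] at this
          · exact (hT.adj (hT.rot (hyy i))).symm)
        (by
          rw [List.toFinset_card_of_nodup]
          · rfl
          · have q : ∀ j : ZMod 5, j ≠ j + 1 ∧ j ≠ j + 2 ∧ j ≠ j + 3 ∧ j + 1 ≠ j + 2 ∧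
              j + 1 ≠ j + 3 ∧ j + 2 ≠ j + 3 := by decide
            have := q i
            simp [hinj.eq_iff, hyx, eq_comm]
            grind)
      have n1 := hN (y (i + 4))
      have n2 := hN (y (i + 3))
      have t1 := hT.adj (hT.rot (hyy (i + 4)))
      have t2 := hT.adj (hT.rot (hyy (i + 2)))
      have t3 := hyy1 (i + 3)
      rw [a41] at t1
      rw [a21, hi] at t2
      rw [a31] at t3
      simp [hyx] at n1 n2
      have := n1.1 t1
      have := n2.1 t2.symm
      grind
    intro i j hij
    rcases hadd i j with rfl | rfl | rfl | rfl | rfl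
    · rfl
    · exact absurd hij.symm (hyy1 _)
    · exact absurd hij.symm (h2 _)
    · exact absurd hij (by
        have := h2 (i + 3)
        rwa [show i + 3 + 2 = i by clear * -; revert i; decide] at this)
    · exact absurd hij (by have := hyy1 (i + 4); rwa [a41] at this)
  obtain ⟨z, hz⟩ : ∃ z, ∀ i, T (y (i + 1)) (y i) z ∧ z ≠ x (i + 1) := by
    choose z hzx hz using fun i => hT.exists_other (hT.rot (hyy i))
    -- The link of `y (i + 1)` is the pentagon `y i`, `x (i + 1)`, `x (i + 2)`, `y (i + 2)`, `e`;
    -- its last vertex is both `z i` and `z (i + 1)`.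
    have step : ∀ i, z (i + 1) = z i := by
      intro i
      have p0 := hT.rot (hT.rot (hxy (i + 1)))
      have p1 := hT.rot (hyy i)
      have hy' := hT.rot (hT.rot (hyy (i + 1)))
      rw [a11] at p0 hy'
      have hne : y i ≠ x (i + 2) := hyx _ _
      obtain ⟨d, e, h1, h2, h3, hn, -⟩ :=
        hT.exists_pentagon hk p1 p0 hne
      simp only [List.nodup_cons, List.mem_cons, List.not_mem_nil, or_false, not_or] at hn
      have hd : d = y (i + 2) := by
        refine hT.third (hT.swap' p0) hy' h1 (hyx _ _).symm ?_
        grind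
      subst hd
      have he : e = z i := by
        refine hT.third p1 (hz i) (hT.swap' h3) ?_ ?_ <;> grind
      have he' : e = z (i + 1) := by
        have q := hz (i + 1)
        rw [a11] at q
        have q2 := hzx (i + 1)
        rw [a11] at q2
        refine hT.third (hT.swap' h1) (hT.swap q) h2 ?_ ?_ <;> grind
      rw [← he, ← he']
    have hconst : ∀ i, z i = z 0 := by
      have s0 := step 0
      have s1 := step 1
      have s2 := step 2
      have s3 := step 3
      intro i
      change Fin 5 at i
      fin_cases i
      · rfl
      · exact s0
      · exact s1.trans s0
      · exact s2.trans (s1.trans s0)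
      · exact s3.trans (s2.trans (s1.trans s0))
    refine ⟨z 0, fun i => ?_⟩
    rw [← hconst i]
    exact ⟨hz i, hzx i⟩
  have hzy : ∀ i, G.Adj z (y i) := fun i => (hT.adj (hT.rot (hz i).1)).symm
  have hzne : ∀ i, z ≠ y i := fun i => (hzy i).ne
  have hzv : z ≠ v := by
    rintro rfl
    obtain ⟨j, hj⟩ := hNv _ (hzy 0)
    exact hyx _ _ hj
  have hzx : ∀ i, z ≠ x i := by
    intro i hi
    have := hzy (i + 2)
    rw [hi, ← a41 i, hNx] at this
    rcases this with h | h | h | h | h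
    · exact hyx _ _ h
    · exact hyv _ h
    · exact hyx _ _ h
    · exact absurd (hyinj _ _ h) (by clear * -; revert i; decide)
    · exact absurd (hyinj _ _ h) (by clear * -; revert i; decide)
  have hvx : ∀ i, G.Adj v (x i) := fun i => hT.adj (hx i)
  have hyinj' : ∀ i j, y i = y j ↔ i = j := fun i j => ⟨hyinj i j, fun h => h ▸ rfl⟩
  refine nonempty_iso_of_injective_hom hG hk icosahedronGraph_isRegularOfDegree
    (fun p => Option.elim p.2 (if p.1 then v else z) (if p.1 then x else y)) ?_ ?_
  · rintro ⟨_ | _, _ | i⟩ ⟨_ | _, _ | j⟩ <;>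
      simp [hyx, hyv, hzne, hzv, hzx, hinj.eq_iff, hyinj', (hvx _).ne, (hvx _).ne', hzv.symm,
        fun i => (hzx i).symm, fun i => (hzne i).symm, fun i => (hyv i).symm,
        fun i j => (hyx i j).symm]
  · intro p q h
    rw [icosahedronGraph_adj_iff] at h
    rcases p with ⟨_ | _, _ | i⟩ <;> rcases q with ⟨_ | _, _ | j⟩ <;> simp at h ⊢
    · exact hzy _
    · exact (hzy _).symm
    · rcases h with rfl | rfl
      · exact hT.adj (hT.rot (hT.rot (hT.swap' (hT.rot (hyy i)))))
      · exact hT.adj (hT.rot (hyy j))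
    · rcases h with rfl | rfl
      · exact hT.adj (hT.rot (hT.rot (hxy _)))
      · exact hT.adj' (hT.rot (hT.rot (hxy _)))
    · exact hvx _
    · rcases h with rfl | rfl
      · exact (hT.adj (hT.rot (hT.rot (hxy _)))).symm
      · exact (hT.adj' (hT.rot (hT.rot (hxy _)))).symm
    · exact (hvx _).symm
    · rcases h with rfl | rfl
      · exact hT.adj (hxy _)
      · exact (hT.adj (hxy _)).symm

end SimpleGraph.IsTriangleSystem

/-! ### The logarithmic potential of a polygonal chain. -/

/-- The sum of the logarithms measuring how the segments of a polygonal chain are seen from `p`. -/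
noncomputable def logPotential (m : ℕ) (c : ℕ → ℂ) (p : ℂ) : ℂ :=
  ∑ i ∈ Finset.range m, Complex.log ((c (i + 1) - p) / (c i - p))

/-- A nonpositive real quotient means that `a` and `b` are seen from `p` in opposite directions. So
the principal logarithm is holomorphic off the segment and no choice of branch is needed. -/
theorem div_mem_slitPlane_of_notMem_segment {a b p : ℂ} (h : p ∉ segment ℝ a b) :
    (b - p) / (a - p) ∈ Complex.slitPlane := by
  have ha : a - p ≠ 0 := by
    intro h0
    rw [sub_eq_zero] at h0
    exact h (h0 ▸ left_mem_segment ℝ a b)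
  by_contra hn
  rw [Complex.mem_slitPlane_iff] at hn
  push Not at hn
  obtain ⟨hre, him⟩ := hn
  set z := (b - p) / (a - p) with hz
  have hzr : z = (z.re : ℂ) := Complex.ext rfl (by simp [him])
  have hb : b - p = z.re * (a - p) := by rw [← hzr, hz]; field_simp
  apply h
  have hpos : 0 < 1 - z.re := by linarith
  have hpos' : (1 - (z.re : ℂ)) ≠ 0 := by exact_mod_cast hpos.ne'
  refine ⟨-z.re / (1 - z.re), 1 / (1 - z.re), div_nonneg (by linarith) hpos.le,
    by positivity, by field_simp; ring, ?_⟩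
  simp only [Complex.real_smul]
  push_cast
  field_simp
  linear_combination hb

theorem hasDerivAt_log_div {a b p : ℂ} (h : p ∉ segment ℝ a b) :
    HasDerivAt (fun p => Complex.log ((b - p) / (a - p))) (1 / (a - p) - 1 / (b - p)) p := by
  have hs := div_mem_slitPlane_of_notMem_segment h
  have h0 := Complex.slitPlane_ne_zero hs
  have ha : a - p ≠ 0 := fun h => h0 (by rw [h, div_zero])
  have hb : b - p ≠ 0 := fun h => h0 (by rw [h, zero_div])
  have h1 : HasDerivAt (fun p => (b - p) / (a - p))
      (((-1) * (a - p) - (b - p) * (-1)) / (a - p) ^ 2) p :=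
    ((hasDerivAt_id p).const_sub b).div ((hasDerivAt_id p).const_sub a) ha
  convert h1.clog hs using 1
  field_simp
  ring

/-- The sum telescopes: interior corners cancel and only the two ends of the chain remain. -/
theorem hasDerivAt_logPotential {m : ℕ} {c : ℕ → ℂ} {p : ℂ}
    (h : ∀ i < m, p ∉ segment ℝ (c i) (c (i + 1))) :
    HasDerivAt (logPotential m c) (1 / (c 0 - p) - 1 / (c m - p)) p := by
  have h1 : HasDerivAt (logPotential m c)
      (∑ i ∈ Finset.range m, (1 / (c i - p) - 1 / (c (i + 1) - p))) p :=
    HasDerivAt.fun_sum fun i hi => hasDerivAt_log_div (h i (Finset.mem_range.1 hi))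
  rwa [Finset.sum_range_sub' (fun i => 1 / (c i - p))] at h1

/-- Along the perpendicular through the midpoint, the quotient runs on the unit circle through -1,
from above the real axis for `t > 0` and from below for `-t`. The logarithms tend to πi and -πi. -/
theorem tendsto_log_div_sub {a b : ℂ} (hab : a ≠ b) :
    Tendsto (fun t : ℝ =>
      Complex.log ((b - ((a + b) / 2 + (t * Complex.I) * (b - a))) /
        (a - ((a + b) / 2 + (t * Complex.I) * (b - a)))) -
      Complex.log ((b - ((a + b) / 2 + (-(t * Complex.I)) * (b - a))) /
        (a - ((a + b) / 2 + (-(t * Complex.I)) * (b - a)))))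
      (𝓝[>] 0) (𝓝 (2 * Real.pi * Complex.I)) := by
  have hd : b - a ≠ 0 := sub_ne_zero.2 hab.symm
  set r : ℝ → ℂ := fun t => ((t ^ 2 - 1 / 4 : ℝ) + t * Complex.I) / (t ^ 2 + 1 / 4 : ℝ) with hr
  have hpos : ∀ t : ℝ, 0 < t ^ 2 + 1 / 4 := fun t => by positivity
  have hne : ∀ t : ℝ, (1 / 2 + t * Complex.I : ℂ) ≠ 0 := by
    intro t h
    have := congrArg Complex.re h
    norm_num at this
  have hne' : ∀ t : ℝ, ((t : ℂ) ^ 2 + 1 / 4) ≠ 0 := by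
    intro t h
    have h' : ((t ^ 2 + 1 / 4 : ℝ) : ℂ) = 0 := by push_cast; exact h
    exact (hpos t).ne' (by exact_mod_cast h')
  have hrt : ∀ t : ℝ, (b - ((a + b) / 2 + (t * Complex.I) * (b - a))) /
        (a - ((a + b) / 2 + (t * Complex.I) * (b - a))) = r t := by
    intro t
    have e1 : b - ((a + b) / 2 + (t * Complex.I) * (b - a)) =
      (b - a) * (1 / 2 - t * Complex.I) := by ring
    have e2 : a - ((a + b) / 2 + (t * Complex.I) * (b - a)) =
      (b - a) * (-(1 / 2 + t * Complex.I)) := by ring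
    rw [e1, e2, mul_div_mul_left _ _ hd, hr]
    push_cast
    rw [div_eq_div_iff (neg_ne_zero.2 (hne t)) (hne' t)]
    linear_combination (t : ℂ) ^ 2 * Complex.I_sq
  have hrt' : ∀ t : ℝ, (b - ((a + b) / 2 + (-(t * Complex.I)) * (b - a))) /
        (a - ((a + b) / 2 + (-(t * Complex.I)) * (b - a))) = r (-t) := by
    intro t
    rw [← hrt]
    push_cast
    ring_nf
  have hr0 : r 0 = -1 := by simp only [hr]; norm_num
  have him : ∀ t, (r t).im = t / (t ^ 2 + 1 / 4) := by
    intro t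
    simp only [hr, Complex.div_ofReal_im]
    simp [pow_two]
  have hcont : Continuous r := by
    simp only [hr]
    refine Continuous.div (by fun_prop) (by fun_prop) fun t => ?_
    exact_mod_cast (hpos t).ne'
  have h1 : Tendsto (fun t : ℝ => Complex.log (r t)) (𝓝[>] 0) (𝓝 (Real.pi * Complex.I)) := by
    have := Complex.continuousWithinAt_log_of_re_neg_of_im_zero (z := -1) (by simp) (by simp)
    rw [ContinuousWithinAt, Complex.log_neg_one] at this
    refine this.comp (tendsto_nhdsWithin_iff.2 ⟨?_, ?_⟩)
    · rw [← hr0]; exact hcont.continuousAt.tendsto.mono_left nhdsWithin_le_nhds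
    · filter_upwards [self_mem_nhdsWithin] with t ht
      rw [him]
      exact div_nonneg (le_of_lt ht) (hpos t).le
  have h2 : Tendsto (fun t : ℝ => Complex.log (r (-t))) (𝓝[>] 0)
      (𝓝 (-(Real.pi * Complex.I))) := by
    have := Complex.tendsto_log_nhdsWithin_im_neg_of_re_neg_of_im_zero (z := -1) (by simp)
      (by simp)
    simp only [norm_neg, norm_one, Real.log_one, Complex.ofReal_zero, zero_sub] at this
    refine this.comp (tendsto_nhdsWithin_iff.2 ⟨?_, ?_⟩)
    · rw [← hr0]
      have h3 : Continuous fun t => r (-t) := hcont.comp continuous_neg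
      have := h3.continuousAt (x := 0)
      rw [ContinuousAt, neg_zero] at this
      exact this.mono_left nhdsWithin_le_nhds
    · filter_upwards [self_mem_nhdsWithin] with t ht
      rw [him]
      exact div_neg_of_neg_of_pos (neg_lt_zero.2 ht) (hpos _)
  simp only [hrt, hrt']
  convert h1.sub h2 using 2
  ring

/-- The potential of a chain jumps by `2πi` across its first segment. -/
theorem tendsto_logPotential_sub {m : ℕ} (hm : 0 < m) {c : ℕ → ℂ} (hc : c 0 ≠ c 1)
    (h : ∀ i, 0 < i → i < m → (c 0 + c 1) / 2 ∉ segment ℝ (c i) (c (i + 1))) :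
    Tendsto (fun t : ℝ =>
      logPotential m c ((c 0 + c 1) / 2 + (t * Complex.I) * (c 1 - c 0)) -
      logPotential m c ((c 0 + c 1) / 2 + (-(t * Complex.I)) * (c 1 - c 0)))
      (𝓝[>] 0) (𝓝 (2 * Real.pi * Complex.I)) := by
  obtain ⟨n, rfl⟩ := Nat.exists_eq_succ_of_ne_zero hm.ne'
  simp only [logPotential, Finset.sum_range_succ', add_sub_add_comm]
  have key := tendsto_log_div_sub hc
  rw [show (2 * Real.pi * Complex.I : ℂ) = 0 + 2 * Real.pi * Complex.I by ring]
  refine Tendsto.add ?_ key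
  have hcont : ∀ s : ℝ, Tendsto (fun t : ℝ => ∑ i ∈ Finset.range n,
      Complex.log ((c (i + 1 + 1) - ((c 0 + c 1) / 2 + (s * (t * Complex.I)) * (c 1 - c 0))) /
        (c (i + 1) - ((c 0 + c 1) / 2 + (s * (t * Complex.I)) * (c 1 - c 0))))) (𝓝[>] 0)
      (𝓝 (∑ i ∈ Finset.range n, Complex.log ((c (i + 1 + 1) - (c 0 + c 1) / 2) /
        (c (i + 1) - (c 0 + c 1) / 2)))) := by
    intro s
    refine tendsto_finsetSum _ fun i hi => ?_
    have h1 := (hasDerivAt_log_div (h (i + 1) (by omega)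
      (by have := Finset.mem_range.1 hi; omega))).continuousAt
    refine h1.tendsto.comp ?_
    have h2 : Continuous fun t : ℝ =>
      (c 0 + c 1) / 2 + (s * (t * Complex.I)) * (c 1 - c 0) := by fun_prop
    have h3 := h2.continuousAt (x := 0)
    rw [ContinuousAt] at h3
    simp only [Complex.ofReal_zero, zero_mul, mul_zero, add_zero] at h3
    exact h3.mono_left nhdsWithin_le_nhds
  have := (hcont 1).sub (hcont (-1))
  simpa using this

/-! ### Segments and polygonal arcs as closed null sets. -/

/-- The standard isometry from the plane to `ℂ`. -/
noncomputable def planeToComplex : Plane ≃ₗᵢ[ℝ] ℂ := Complex.orthonormalBasisOneI.repr.symm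

theorem planeToComplex_mem_segment {p a b : Plane} :
    planeToComplex p ∈ segment ℝ (planeToComplex a) (planeToComplex b) ↔ p ∈ segment ℝ a b := by
  have h := image_segment ℝ planeToComplex.toLinearEquiv.toLinearMap.toAffineMap a b
  have h' : planeToComplex '' segment ℝ a b =
    segment ℝ (planeToComplex a) (planeToComplex b) := h
  rw [← h', planeToComplex.injective.mem_set_image]

theorem isClosed_segment (a b : Plane) : IsClosed (segment ℝ a b) := by
  rw [segment_eq_image_lineMap]
  exact (isCompact_Icc.image AffineMap.lineMap_continuous).isClosed

theorem volume_segment (a b : Plane) : MeasureTheory.volume (segment ℝ a b) = 0 := by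
  have h : (line[ℝ, a, b] : AffineSubspace ℝ Plane) ≠ ⊤ := by
    intro h
    have h1 : Module.finrank ℝ (vectorSpan ℝ {a, b}) ≤ 1 := (collinear_pair ℝ a b).finrank_le_one
    rw [← direction_affineSpan, h, AffineSubspace.direction_top, finrank_top,
      finrank_euclideanSpace_fin] at h1
    omega
  refine MeasureTheory.measure_mono_null ?_
    (MeasureTheory.Measure.addHaar_affineSubspace MeasureTheory.volume _ h)
  rw [← convexHull_pair]
  exact convexHull_subset_affineSpan _

theorem IsPolygonalArc.isClosed {A : Set Plane} {p q : Plane} (h : IsPolygonalArc A p q) :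
    IsClosed A := by
  obtain ⟨m, c, -, -, -, -, -, rfl⟩ := h
  exact (Set.finite_Iio m).isClosed_biUnion fun i _ => isClosed_segment _ _

theorem IsPolygonalArc.volume_eq_zero {A : Set Plane} {p q : Plane} (h : IsPolygonalArc A p q) :
    MeasureTheory.volume A = 0 := by
  obtain ⟨m, c, -, -, -, -, -, rfl⟩ := h
  exact (MeasureTheory.measure_biUnion_null_iff (Set.finite_Iio m).countable).2
    fun i _ => volume_segment _ _

/-! ### The local picture at an edge, and the faces of a drawing. -/

namespace PlaneDrawing

variable {V : Type*} {G : SimpleGraph V} (D : PlaneDrawing G)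

/-- A chosen first end of an edge. -/
noncomputable def tail (e : G.edgeSet) : V := (e : Sym2 V).out.1

/-- The end of an edge other than `tail`. -/
noncomputable def head (e : G.edgeSet) : V := (e : Sym2 V).out.2

theorem mk_tail_head (e : G.edgeSet) : s(tail e, head e) = (e : Sym2 V) := Quot.out_eq _

theorem adj_tail_head (e : G.edgeSet) : G.Adj (tail e) (head e) := by
  rw [← SimpleGraph.mem_edgeSet, mk_tail_head]; exact e.2

theorem isPolygonalArc_arc (e : G.edgeSet) :
    IsPolygonalArc (D.arc e) (D.point (tail e)) (D.point (head e)) := by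
  have := D.isPolygonalArc _ _ (adj_tail_head e)
  rwa [mk_tail_head] at this

/-- The number of segments of an edge. -/
noncomputable def length (e : G.edgeSet) : ℕ := (D.isPolygonalArc_arc e).choose

/-- The corners of an edge. -/
noncomputable def corner (e : G.edgeSet) : ℕ → Plane := (D.isPolygonalArc_arc e).choose_spec.choose

theorem corner_spec (e : G.edgeSet) :
    0 < D.length e ∧ D.corner e 0 = D.point (tail e) ∧
    D.corner e (D.length e) = D.point (head e) ∧
    (∀ i < D.length e, D.corner e i ≠ D.corner e (i + 1)) ∧
    (∀ i j, i < j → j < D.length e →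
      segment ℝ (D.corner e i) (D.corner e (i + 1)) ∩
        segment ℝ (D.corner e j) (D.corner e (j + 1)) =
        if j = i + 1 then {D.corner e j} else ∅) ∧
    D.arc e = ⋃ i ∈ Set.Iio (D.length e), segment ℝ (D.corner e i) (D.corner e (i + 1)) :=
  (D.isPolygonalArc_arc e).choose_spec.choose_spec

/-- The corners of an edge as complex numbers. -/
noncomputable def cornerC (e : G.edgeSet) (i : ℕ) : ℂ := planeToComplex (D.corner e i)

/-- Affine coordinates of the plane in which the first segment of `e` is `[-1/2, 1/2]`. -/
noncomputable def chart (e : G.edgeSet) (w : ℂ) : Plane :=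
  planeToComplex.symm
    ((D.cornerC e 0 + D.cornerC e 1) / 2 + w * (D.cornerC e 1 - D.cornerC e 0))

theorem continuous_chart (e : G.edgeSet) : Continuous (D.chart e) :=
  planeToComplex.symm.continuous.comp (by fun_prop)

theorem planeToComplex_chart (e : G.edgeSet) (w : ℂ) : planeToComplex (D.chart e w) =
    (D.cornerC e 0 + D.cornerC e 1) / 2 + w * (D.cornerC e 1 - D.cornerC e 0) := by
  simp [chart]

theorem cornerC_ne (e : G.edgeSet) : D.cornerC e 0 ≠ D.cornerC e 1 :=
  planeToComplex.injective.ne ((D.corner_spec e).2.2.2.1 0 (D.corner_spec e).1)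

theorem isOpenMap_chart (e : G.edgeSet) : IsOpenMap (D.chart e) := by
  have h : D.cornerC e 1 - D.cornerC e 0 ≠ 0 := sub_ne_zero.2 (D.cornerC_ne e).symm
  exact planeToComplex.symm.toHomeomorph.isOpenMap.comp
    ((Homeomorph.mulRight₀ _ h).trans (Homeomorph.addLeft _)).isOpenMap

theorem chart_mem_segment_iff (e : G.edgeSet) (w : ℂ) :
    D.chart e w ∈ segment ℝ (D.corner e 0) (D.corner e 1) ↔ w.im = 0 ∧ |w.re| ≤ 1 / 2 := by
  have h : D.cornerC e 1 - D.cornerC e 0 ≠ 0 := sub_ne_zero.2 (D.cornerC_ne e).symm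
  rw [← planeToComplex_mem_segment, planeToComplex_chart]
  change _ ∈ segment ℝ (D.cornerC e 0) (D.cornerC e 1) ↔ _
  constructor
  · rintro ⟨a, b, ha, hb, hab, hw⟩
    have hab' : (a : ℂ) = 1 - b := by exact_mod_cast eq_sub_of_add_eq hab
    simp only [Complex.real_smul] at hw
    rw [hab'] at hw
    have hw' : w = ((b - 1 / 2 : ℝ) : ℂ) := by
      apply mul_right_cancel₀ h
      push_cast
      linear_combination -hw
    rw [hw']
    refine ⟨Complex.ofReal_im _, ?_⟩
    rw [Complex.ofReal_re, abs_le]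
    constructor <;> linarith
  · rintro ⟨him, hre⟩
    rw [abs_le] at hre
    have hw : w = (w.re : ℂ) := Complex.ext rfl (by simp [him])
    refine ⟨1 / 2 - w.re, 1 / 2 + w.re, by linarith, by linarith, by ring, ?_⟩
    rw [hw]
    simp only [Complex.real_smul, Complex.ofReal_re]
    push_cast
    ring

theorem segment_subset_arc (e : G.edgeSet) {i : ℕ} (hi : i < D.length e) :
    segment ℝ (D.corner e i) (D.corner e (i + 1)) ⊆ D.arc e := by
  rw [(D.corner_spec e).2.2.2.2.2]
  exact Set.subset_biUnion_of_mem (u := fun i => segment ℝ (D.corner e i) (D.corner e (i + 1)))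
    (Set.mem_Iio.2 hi)

theorem chart_zero_mem_segment (e : G.edgeSet) :
    D.chart e 0 ∈ segment ℝ (D.corner e 0) (D.corner e 1) :=
  (D.chart_mem_segment_iff e 0).2 (by norm_num)

theorem chart_zero_mem_arc (e : G.edgeSet) : D.chart e 0 ∈ D.arc e :=
  D.segment_subset_arc e (D.corner_spec e).1 (D.chart_zero_mem_segment e)

theorem chart_zero_ne (e : G.edgeSet) :
    D.chart e 0 ≠ D.corner e 0 ∧ D.chart e 0 ≠ D.corner e 1 := by
  have h := D.cornerC_ne e
  constructor <;> intro h' <;> apply h <;> apply_fun planeToComplex at h' <;>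
    rw [planeToComplex_chart] at h'
  · change _ = D.cornerC e 0 at h'
    linear_combination -2 * h'
  · change _ = D.cornerC e 1 at h'
    linear_combination 2 * h'

theorem chart_zero_notMem_segment (e : G.edgeSet) {i : ℕ} (h0 : 0 < i) (hi : i < D.length e) :
    D.chart e 0 ∉ segment ℝ (D.corner e i) (D.corner e (i + 1)) := by
  intro h
  have h1 : D.chart e 0 ∈ segment ℝ (D.corner e 0) (D.corner e (0 + 1)) ∩
    segment ℝ (D.corner e i) (D.corner e (i + 1)) := ⟨D.chart_zero_mem_segment e, h⟩
  rw [(D.corner_spec e).2.2.2.2.1 0 i h0 hi] at h1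
  split_ifs at h1 with h2
  · rw [zero_add] at h2
    subst h2
    exact (D.chart_zero_ne e).2 h1
  · exact h1

theorem chart_zero_notMem_range (e : G.edgeSet) : D.chart e 0 ∉ Set.range D.point := by
  rintro ⟨v, hv⟩
  have hve := D.mem_of_point_mem e e.2 v (hv ▸ D.chart_zero_mem_arc e)
  obtain ⟨hm, h0, h1, -⟩ := D.corner_spec e
  rw [← mk_tail_head, Sym2.mem_iff] at hve
  rcases hve with rfl | rfl
  · exact (D.chart_zero_ne e).1 (by rw [h0, hv])
  · rw [← h1] at hv
    rcases Nat.lt_or_ge 1 (D.length e) with h | h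
    · apply D.chart_zero_notMem_segment e (i := D.length e - 1) (by omega) (by omega)
      rw [← hv, Nat.sub_add_cancel hm]
      exact right_mem_segment ℝ _ _
    · have : D.length e = 1 := by omega
      rw [this] at hv
      exact (D.chart_zero_ne e).2 hv.symm

theorem eq_of_mem_arc_of_mem_arc {e e' : Sym2 V} (he : e ∈ G.edgeSet) (he' : e' ∈ G.edgeSet)
    {p : Plane} (hp : p ∈ D.arc e) (hp' : p ∈ D.arc e') (hv : p ∉ Set.range D.point) : e = e' := by
  by_contra hne
  obtain ⟨v, -, hv'⟩ := D.inter_subset e he e' he' hne ⟨hp, hp'⟩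
  exact hv ⟨v, hv'⟩

theorem isClosed_arc {e : Sym2 V} (he : e ∈ G.edgeSet) : IsClosed (D.arc e) :=
  (D.isPolygonalArc_arc ⟨e, he⟩).isClosed

theorem arc_subset_support {e : Sym2 V} (he : e ∈ G.edgeSet) : D.arc e ⊆ D.support :=
  fun _ hp => Or.inr (Set.mem_biUnion he hp)

section

variable {D}

theorem IsFace.subset {F : Set Plane} (hF : D.IsFace F) : F ⊆ D.supportᶜ := by
  obtain ⟨x, -, rfl⟩ := hF
  exact connectedComponentIn_subset _ _

theorem IsFace.isPreconnected {F : Set Plane} (hF : D.IsFace F) : IsPreconnected F := by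
  obtain ⟨x, -, rfl⟩ := hF
  exact isPreconnected_connectedComponentIn

theorem IsFace.nonempty {F : Set Plane} (hF : D.IsFace F) : F.Nonempty := by
  obtain ⟨x, hx, rfl⟩ := hF
  exact ⟨x, mem_connectedComponentIn hx⟩

theorem IsFace.eq_connectedComponentIn {F : Set Plane} (hF : D.IsFace F) {p : Plane}
    (hp : p ∈ F) : F = connectedComponentIn D.supportᶜ p := by
  obtain ⟨x, -, rfl⟩ := hF
  exact connectedComponentIn_eq hp

theorem IsFace.eq_of_mem {F F' : Set Plane} (hF : D.IsFace F) (hF' : D.IsFace F') {p : Plane}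
    (hp : p ∈ F) (hp' : p ∈ F') : F = F' := by
  rw [hF.eq_connectedComponentIn hp, hF'.eq_connectedComponentIn hp']

theorem exists_isFace_mem {p : Plane} (hp : p ∉ D.support) : ∃ F, D.IsFace F ∧ p ∈ F :=
  ⟨_, ⟨p, hp, rfl⟩, mem_connectedComponentIn hp⟩

theorem IsFace.subset_of_isPreconnected {F : Set Plane} (hF : D.IsFace F) {s : Set Plane}
    (hs : IsPreconnected s) (hsub : s ⊆ D.supportᶜ) {p : Plane} (hp : p ∈ s) (hpF : p ∈ F) :
    s ⊆ F := by
  rw [hF.eq_connectedComponentIn hpF]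
  exact hs.subset_connectedComponentIn hp hsub

end

section Finite

variable [Finite V]

theorem isClosed_support : IsClosed D.support :=
  (Set.finite_range _).isClosed.union
    ((Set.toFinite _).isClosed_biUnion fun _ he => D.isClosed_arc he)

theorem volume_support : MeasureTheory.volume D.support = 0 := by
  refine MeasureTheory.measure_union_null ((Set.finite_range _).measure_zero _) ?_
  exact (MeasureTheory.measure_biUnion_null_iff (Set.toFinite _).countable).2
    fun e he => (D.isPolygonalArc_arc ⟨e, he⟩).volume_eq_zero

theorem dense_compl_support : Dense D.supportᶜ := by
  rw [← interior_eq_empty_iff_dense_compl]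
  exact MeasureTheory.Measure.interior_eq_empty_of_null D.volume_support

/-- The other segments, the other edges and the vertices form a closed set missing the midpoint of
the first segment, so near it the drawing is a straight line. -/
theorem exists_radius (e : G.edgeSet) : ∃ ρ > 0, ∀ w : ℂ, ‖w‖ < ρ →
    (D.chart e w ∈ D.support ↔ w.im = 0) := by
  set K : Set Plane := (⋃ i ∈ Set.Ioo 0 (D.length e),
      segment ℝ (D.corner e i) (D.corner e (i + 1))) ∪
    (Set.range D.point ∪ ⋃ e' ∈ G.edgeSet \ {(e : Sym2 V)}, D.arc e') with hK
  have hKc : IsClosed K :=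
    ((Set.finite_Ioo _ _).isClosed_biUnion fun _ _ => isClosed_segment _ _).union
      ((Set.finite_range _).isClosed.union
        ((Set.toFinite _).isClosed_biUnion fun _ he => D.isClosed_arc he.1))
  have h0 : D.chart e 0 ∉ K := by
    rintro (h | h | h)
    · obtain ⟨i, hi, h⟩ := Set.mem_iUnion₂.1 h
      exact D.chart_zero_notMem_segment e hi.1 hi.2 h
    · exact D.chart_zero_notMem_range e h
    · obtain ⟨e', he', h⟩ := Set.mem_iUnion₂.1 h
      exact he'.2 (D.eq_of_mem_arc_of_mem_arc he'.1 e.2 h (D.chart_zero_mem_arc e)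
        (D.chart_zero_notMem_range e))
  have hopen : IsOpen (D.chart e ⁻¹' Kᶜ) := hKc.isOpen_compl.preimage (D.continuous_chart e)
  obtain ⟨ρ, hρ, hball⟩ := Metric.isOpen_iff.1 hopen 0 h0
  refine ⟨min ρ (1 / 2), lt_min hρ (by norm_num), fun w hw => ?_⟩
  rw [lt_min_iff] at hw
  have hwK : D.chart e w ∉ K := hball (by simpa using hw.1)
  constructor
  · intro hs
    rcases hs with hs | hs
    · exact absurd (Or.inr (Or.inl hs)) hwK
    · obtain ⟨e', he', hs⟩ := Set.mem_iUnion₂.1 hs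
      by_cases hee : e' = e
      · subst hee
        rw [(D.corner_spec e).2.2.2.2.2] at hs
        obtain ⟨i, hi, hs⟩ := Set.mem_iUnion₂.1 hs
        rcases Nat.eq_zero_or_pos i with rfl | hi0
        · exact ((D.chart_mem_segment_iff e w).1 hs).1
        · exact absurd (Or.inl (Set.mem_biUnion (Set.mem_Ioo.2 ⟨hi0, hi⟩) hs)) hwK
      · exact absurd (Or.inr (Or.inr (Set.mem_biUnion
          (show e' ∈ G.edgeSet \ {(e : Sym2 V)} from ⟨he', hee⟩) hs))) hwK
  · intro him
    apply D.arc_subset_support e.2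
    apply D.segment_subset_arc e (D.corner_spec e).1
    exact (D.chart_mem_segment_iff e w).2 ⟨him, (Complex.abs_re_le_norm w).trans hw.2.le⟩

variable {D}

theorem IsFace.isOpen {F : Set Plane} (hF : D.IsFace F) : IsOpen F := by
  obtain ⟨x, -, rfl⟩ := hF
  exact D.isClosed_support.isOpen_compl.connectedComponentIn

theorem IsFace.mem_of_mem_closure {F : Set Plane} (hF : D.IsFace F) {p : Plane}
    (hp : p ∈ closure F) (hs : p ∉ D.support) : p ∈ F := by
  obtain ⟨F', hF', hpF'⟩ := exists_isFace_mem hs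
  obtain ⟨q, hq', hq⟩ := mem_closure_iff.1 hp F' hF'.isOpen hpF'
  rwa [hF.eq_of_mem hF' hq hq']

theorem IsFace.frontier_eq {F : Set Plane} (hF : D.IsFace F) :
    frontier F = closure F ∩ D.support := by
  rw [hF.isOpen.frontier_eq]
  ext p
  constructor
  · rintro ⟨h1, h2⟩
    exact ⟨h1, by_contra fun h => h2 (hF.mem_of_mem_closure h1 h)⟩
  · rintro ⟨h1, h2⟩
    exact ⟨h1, fun h => hF.subset h h2⟩

variable (D)

/-- The two half-discs at the midpoint are convex and avoid the drawing, so each lies in one face.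
Nothing prevents the two faces from coinciding at this stage. -/
theorem exists_sides (e : G.edgeSet) : ∃ ρ > 0, ∃ F₁ F₂, D.IsFace F₁ ∧ D.IsFace F₂ ∧
    (∀ w : ℂ, ‖w‖ < ρ → 0 < w.im → D.chart e w ∈ F₁) ∧
    (∀ w : ℂ, ‖w‖ < ρ → w.im < 0 → D.chart e w ∈ F₂) ∧
    D.chart e 0 ∈ closure F₁ ∧ D.chart e 0 ∈ closure F₂ ∧
    ∀ F, D.IsFace F → D.chart e 0 ∈ closure F → F = F₁ ∨ F = F₂ := by
  obtain ⟨ρ, hρ, hsupp⟩ := D.exists_radius e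
  have side : ∀ s : Set ℝ, Convex ℝ s → (0 : ℝ) ∉ s → (∀ ε > 0, ∃ y ∈ s, |y| < ε) →
      ∃ F, D.IsFace F ∧ (∀ w : ℂ, ‖w‖ < ρ → w.im ∈ s → D.chart e w ∈ F) ∧
        D.chart e 0 ∈ closure F := by
    intro s hs h0 hsmall
    have hconv : Convex ℝ (Metric.ball (0 : ℂ) ρ ∩ Complex.imLm ⁻¹' s) :=
      (convex_ball _ _).inter (hs.linear_preimage Complex.imLm)
    have hpre := (hconv.isPreconnected).image _ (D.continuous_chart e).continuousOn
    have hsub : D.chart e '' (Metric.ball (0 : ℂ) ρ ∩ Complex.imLm ⁻¹' s) ⊆ D.supportᶜ := by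
      rintro _ ⟨w, ⟨hw, hw'⟩, rfl⟩ hmem
      rw [hsupp w (by simpa using hw)] at hmem
      exact h0 (hmem ▸ hw')
    have hI : ∀ y : ℝ, ‖(y * Complex.I : ℂ)‖ = |y| := by intro y; simp
    obtain ⟨y, hys, hy⟩ := hsmall ρ hρ
    have hymem : D.chart e (y * Complex.I) ∈
        D.chart e '' (Metric.ball (0 : ℂ) ρ ∩ Complex.imLm ⁻¹' s) :=
      ⟨_, ⟨by simpa using hy, by simpa using hys⟩, rfl⟩
    obtain ⟨F, hF, hyF⟩ := exists_isFace_mem (hsub hymem)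
    have hall := hF.subset_of_isPreconnected hpre hsub hymem hyF
    refine ⟨F, hF, fun w hw hws => hall ⟨w, ⟨by simpa using hw, hws⟩, rfl⟩, ?_⟩
    rw [mem_closure_iff]
    intro o ho h0o
    obtain ⟨ε, hε, hball⟩ := Metric.isOpen_iff.1 (ho.preimage (D.continuous_chart e)) 0 h0o
    obtain ⟨z, hzs, hz⟩ := hsmall (min ε ρ) (lt_min hε hρ)
    rw [lt_min_iff] at hz
    exact ⟨D.chart e (z * Complex.I), hball (by simpa using hz.1),
      hall ⟨_, ⟨by simpa using hz.2, by simpa using hzs⟩, rfl⟩⟩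
  obtain ⟨F₁, hF₁, h₁, h₁'⟩ := side (Set.Ioi 0) (convex_Ioi 0) (by simp)
    fun ε hε => ⟨ε / 2, by simpa using hε, by rw [abs_of_pos (by linarith)]; linarith⟩
  obtain ⟨F₂, hF₂, h₂, h₂'⟩ := side (Set.Iio 0) (convex_Iio 0) (by simp)
    fun ε hε => ⟨-(ε / 2), by simpa using hε, by rw [abs_neg, abs_of_pos (by linarith)]; linarith⟩
  refine ⟨ρ, hρ, F₁, F₂, hF₁, hF₂, h₁, h₂, h₁', h₂', fun F hF h0 => ?_⟩
  obtain ⟨_, ⟨w, hw, rfl⟩, hwF⟩ := mem_closure_iff.1 h0 _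
    (D.isOpenMap_chart e _ Metric.isOpen_ball) ⟨0, Metric.mem_ball_self hρ, rfl⟩
  have hw' : ‖w‖ < ρ := by simpa using hw
  rcases lt_trichotomy w.im 0 with h | h | h
  · exact Or.inr (hF.eq_of_mem hF₂ hwF (h₂ w hw' h))
  · exact absurd ((hsupp w hw').2 h) (hF.subset hwF)
  · exact Or.inl (hF.eq_of_mem hF₁ hwF (h₁ w hw' h))

end Finite

end PlaneDrawing

/-! ### Cycle space, potentials and Euler's inequality. -/

namespace PlaneDrawing

variable {V : Type*} {G : SimpleGraph V} (D : PlaneDrawing G)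

theorem notMem_segment_of_notMem_arc {e : G.edgeSet} {p : Plane} (hp : p ∉ D.arc e) {i : ℕ}
    (hi : i < D.length e) :
    planeToComplex p ∉ segment ℝ (D.cornerC e i) (D.cornerC e (i + 1)) := fun h =>
  hp (D.segment_subset_arc e hi (planeToComplex_mem_segment.1 h))

section

variable [DecidableEq V]

/-- The `1`-chain of the edge `uw` oriented from `u` to `w`. -/
noncomputable def orientedEdge (u w : V) (e : G.edgeSet) : ℂ :=
  if tail e = u ∧ head e = w then 1 else if tail e = w ∧ head e = u then -1 else 0

theorem orientedEdge_of_ne {u w : V} {e : G.edgeSet} (h : (e : Sym2 V) ≠ s(u, w)) :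
    orientedEdge u w e = 0 := by
  rw [← mk_tail_head, ne_eq, Sym2.eq_iff] at h
  simp only [orientedEdge]
  split_ifs <;> tauto

theorem orientedEdge_ne_zero {u w : V} {e : G.edgeSet} (h : (e : Sym2 V) = s(u, w)) :
    orientedEdge u w e ≠ 0 := by
  rw [← mk_tail_head, Sym2.eq_iff] at h
  simp only [orientedEdge]
  split_ifs <;> first | tauto | norm_num

end

section Boundary

variable [Fintype G.edgeSet] [DecidableEq V]

/-- The boundary map from `1`-chains to `0`-chains of `G`. -/
noncomputable def boundary : (G.edgeSet → ℂ) →ₗ[ℂ] (V → ℂ) :=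
  ∑ e : G.edgeSet, (LinearMap.proj e).smulRight
    (Pi.single (head e) (1 : ℂ) - Pi.single (tail e) 1 : V → ℂ)

theorem boundary_apply (z : G.edgeSet → ℂ) : boundary z =
    ∑ e, z e • (Pi.single (head e) (1 : ℂ) - Pi.single (tail e) 1 : V → ℂ) := by
  simp [boundary]

/-- Adjointness of boundary and coboundary: a cycle annihilates all differences of a vertex
function. -/
theorem sum_boundary_mul [Fintype V] (z : G.edgeSet → ℂ) (g : V → ℂ) :
    ∑ v, boundary z v * g v = ∑ e, z e * (g (head e) - g (tail e)) := by
  simp only [boundary_apply, Finset.sum_apply, Finset.sum_mul]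
  rw [Finset.sum_comm]
  refine Finset.sum_congr rfl fun e _ => ?_
  simp [mul_assoc, sub_mul, ← Finset.mul_sum, Finset.sum_sub_distrib, Pi.single_apply]

theorem boundary_orientedEdge {u w : V} (h : G.Adj u w) :
    boundary (orientedEdge (G := G) u w) = Pi.single w 1 - Pi.single u 1 := by
  rw [boundary_apply, Finset.sum_eq_single ⟨s(u, w), h⟩]
  · set e : G.edgeSet := ⟨s(u, w), h⟩
    have he : s(tail e, head e) = s(u, w) := mk_tail_head e
    have hne := h.ne
    rw [Sym2.eq_iff] at he
    rcases he with ⟨h1, h2⟩ | ⟨h1, h2⟩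
    · simp [orientedEdge, h1, h2]
    · simp [orientedEdge, h1, h2, hne, hne.symm]
  · intro e _ he
    rw [orientedEdge_of_ne fun h' => he (Subtype.ext h'), zero_smul]
  · simp

theorem exists_cycle {a b c : V} (hab : G.Adj a b) (hbc : G.Adj b c) (hca : G.Adj c a)
    {e : G.edgeSet} (he : (e : Sym2 V) = s(a, b)) :
    ∃ z : G.edgeSet → ℂ, boundary z = 0 ∧ z e ≠ 0 := by
  refine ⟨orientedEdge a b + orientedEdge b c + orientedEdge c a, ?_, ?_⟩
  · rw [map_add, map_add, boundary_orientedEdge hab, boundary_orientedEdge hbc,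
      boundary_orientedEdge hca]
    ring
  · have := hab.ne
    have := hbc.ne
    have := hca.ne
    rw [Pi.add_apply, Pi.add_apply, orientedEdge_of_ne (u := b), orientedEdge_of_ne (u := c),
      add_zero, add_zero]
    · exact orientedEdge_ne_zero he
    · rw [he, ne_eq, Sym2.eq_iff]; tauto
    · rw [he, ne_eq, Sym2.eq_iff]; tauto

/-- Boundaries have coordinate sum zero, so they form a proper subspace. -/
theorem finrank_range_boundary_lt [Fintype V] [Nonempty V] :
    Module.finrank ℂ (LinearMap.range (boundary (G := G))) < Fintype.card V := by
  rw [← Module.finrank_fintype_fun_eq_card ℂ]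
  apply Submodule.finrank_lt
  intro h
  obtain ⟨v⟩ := ‹Nonempty V›
  have hv : (Pi.single v 1 : V → ℂ) ∈ LinearMap.range (boundary (G := G)) := by rw [h]; trivial
  obtain ⟨z, hz⟩ := hv
  have := sum_boundary_mul z 1
  rw [hz] at this
  simp at this

end Boundary

section Potential

variable [Fintype G.edgeSet]

/-- The potential of a `1`-chain. -/
noncomputable def potential (z : G.edgeSet → ℂ) (p : Plane) : ℂ :=
  ∑ e, z e * logPotential (D.length e) (D.cornerC e) (planeToComplex p)

theorem tendsto_potential_sub (z : G.edgeSet → ℂ) (e : G.edgeSet) :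
    Tendsto (fun t : ℝ => D.potential z (D.chart e (t * Complex.I)) -
      D.potential z (D.chart e (-(t * Complex.I)))) (𝓝[>] 0)
      (𝓝 (z e * (2 * Real.pi * Complex.I))) := by
  classical
  have hlim : z e * (2 * Real.pi * Complex.I) =
      ∑ e', z e' * (if e' = e then 2 * Real.pi * Complex.I else 0) := by simp
  simp only [potential, ← Finset.sum_sub_distrib, ← mul_sub]
  rw [hlim]
  -- Only the summand of `e` jumps; the midpoint lies on no other edge, so the other summands are
  -- continuous there.
  refine tendsto_finsetSum _ fun e' _ => Tendsto.const_mul _ ?_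
  split_ifs with h
  · subst h
    simp only [planeToComplex_chart]
    refine tendsto_logPotential_sub (D.corner_spec e').1 (D.cornerC_ne e') fun i h0 hi hmem => ?_
    apply D.chart_zero_notMem_segment e' h0 hi
    rw [← planeToComplex_mem_segment, planeToComplex_chart]
    rw [zero_mul, add_zero]
    exact hmem
  · have hnot : D.chart e 0 ∉ D.arc e' := fun hmem => h (Subtype.ext
      (D.eq_of_mem_arc_of_mem_arc e'.2 e.2 hmem (D.chart_zero_mem_arc e)
        (D.chart_zero_notMem_range e)))
    have hc := (hasDerivAt_logPotential (m := D.length e') (c := D.cornerC e')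
      (p := planeToComplex (D.chart e 0))
      fun i hi => D.notMem_segment_of_notMem_arc hnot hi).continuousAt
    have hlim : ∀ s : ℝ, Tendsto (fun t : ℝ => logPotential (D.length e') (D.cornerC e')
        (planeToComplex (D.chart e (s * (t * Complex.I))))) (𝓝[>] 0)
        (𝓝 (logPotential (D.length e') (D.cornerC e') (planeToComplex (D.chart e 0)))) := by
      intro s
      refine hc.tendsto.comp ?_
      have h2 : Continuous fun t : ℝ => planeToComplex (D.chart e (s * (t * Complex.I))) :=
        planeToComplex.continuous.comp ((D.continuous_chart e).comp (by fun_prop))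
      have h3 := h2.continuousAt (x := 0)
      rw [ContinuousAt] at h3
      simp only [Complex.ofReal_zero, zero_mul, mul_zero] at h3
      exact h3.mono_left nhdsWithin_le_nhds
    have := (hlim 1).sub (hlim (-1))
    simpa using this

variable {D} [Fintype V] [DecidableEq V]

/-- The potential of a cycle is constant on each face. -/
theorem IsFace.potential_eq {F : Set Plane} (hF : D.IsFace F) {z : G.edgeSet → ℂ}
    (hz : boundary z = 0) {p q : Plane} (hp : p ∈ F) (hq : q ∈ F) :
    D.potential z p = D.potential z q := by
  set f : ℂ → ℂ := fun x => ∑ e, z e * logPotential (D.length e) (D.cornerC e) x with hf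
  have hder : ∀ x ∈ planeToComplex '' F, HasDerivAt f 0 x := by
    rintro _ ⟨p, hp, rfl⟩
    have hnot : ∀ e : G.edgeSet, p ∉ D.arc e := fun e h =>
      hF.subset hp (D.arc_subset_support e.2 h)
    have hterm : ∀ e : G.edgeSet, HasDerivAt
        (fun x => z e * logPotential (D.length e) (D.cornerC e) x)
        (z e * (1 / (D.cornerC e 0 - planeToComplex p) -
          1 / (D.cornerC e (D.length e) - planeToComplex p))) (planeToComplex p) := by
      intro e
      have h := hasDerivAt_logPotential (m := D.length e) (c := D.cornerC e)
        (p := planeToComplex p) fun i hi => D.notMem_segment_of_notMem_arc (hnot e) hi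
      exact h.const_mul (z e)
    have h1 := HasDerivAt.fun_sum (u := Finset.univ) fun e _ => hterm e
    -- The derivative is the pairing of `boundary z` with this vertex function.
    have h2 := sum_boundary_mul z fun v => -(1 / (planeToComplex (D.point v) - planeToComplex p))
    rw [hz] at h2
    simp only [Pi.zero_apply, zero_mul, Finset.sum_const_zero] at h2
    have h3 : ∑ e, z e * (1 / (D.cornerC e 0 - planeToComplex p) -
        1 / (D.cornerC e (D.length e) - planeToComplex p)) = 0 := by
      rw [h2]
      refine Finset.sum_congr rfl fun e _ => ?_
      rw [cornerC, cornerC, (D.corner_spec e).2.1, (D.corner_spec e).2.2.1]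
      ring
    rwa [h3] at h1
  have hopen : IsOpen (planeToComplex '' F) :=
    planeToComplex.toHomeomorph.isOpenMap _ hF.isOpen
  have hpre : IsPreconnected (planeToComplex '' F) :=
    hF.isPreconnected.image _ planeToComplex.continuous.continuousOn
  exact hopen.is_const_of_deriv_eq_zero hpre
    (fun x hx => (hder x hx).differentiableAt.differentiableWithinAt)
    (fun x hx => (hder x hx).deriv) (Set.mem_image_of_mem _ hp) (Set.mem_image_of_mem _ hq)

variable (D)

/-- The two sides of an edge, and the jump of the potential of a cycle between them. -/
theorem exists_sides_potential (e : G.edgeSet) : ∃ F₁ F₂, D.IsFace F₁ ∧ D.IsFace F₂ ∧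
    D.chart e 0 ∈ closure F₁ ∧ D.chart e 0 ∈ closure F₂ ∧
    (∀ F, D.IsFace F → D.chart e 0 ∈ closure F → F = F₁ ∨ F = F₂) ∧
    ∀ z : G.edgeSet → ℂ, boundary z = 0 → ∀ p ∈ F₁, ∀ q ∈ F₂,
      D.potential z p - D.potential z q = z e * (2 * Real.pi * Complex.I) := by
  obtain ⟨ρ, hρ, F₁, F₂, hF₁, hF₂, h₁, h₂, h₁', h₂', hall⟩ := D.exists_sides e
  refine ⟨F₁, F₂, hF₁, hF₂, h₁', h₂', hall, fun z hz p hp q hq => ?_⟩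
  refine tendsto_nhds_unique (Tendsto.congr' ?_ tendsto_const_nhds) (D.tendsto_potential_sub z e)
  filter_upwards [Ioo_mem_nhdsGT hρ] with t ht
  have h0 : 0 < t := ht.1
  have hn : ‖(t * Complex.I : ℂ)‖ < ρ := by simpa [abs_of_pos h0] using ht.2
  rw [hF₁.potential_eq hz hp (h₁ (t * Complex.I) hn (by simpa using h0)),
    hF₂.potential_eq hz hq (h₂ (-(t * Complex.I)) (by rwa [norm_neg]) (by simpa using h0))]

/-- The inequality between the numbers of edges, faces and vertices in Euler's formula that says
that the plane has genus zero. -/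
theorem card_edges_add_two_le [Nonempty V] (hfin : {F | D.IsFace F}.Finite) :
    Fintype.card G.edgeSet + 2 ≤ Nat.card {F // D.IsFace F} + Fintype.card V := by
  have : Finite {F // D.IsFace F} := hfin
  have := Fintype.ofFinite {F // D.IsFace F}
  choose pt hpt using fun F : {F // D.IsFace F} => F.2.nonempty
  -- Evaluation at one point of each face. It is injective because the jumps recover `z`; the factor
  -- `ℂ` accounts for constants and supplies the second unit in `+ 2`, the first coming from the
  -- rank bound on `boundary`.
  let Φ : (LinearMap.ker (boundary (G := G)) × ℂ) →ₗ[ℂ] ({F // D.IsFace F} → ℂ) :=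
    { toFun := fun zc F => D.potential zc.1 (pt F) + zc.2
      map_add' := by
        intro x y
        ext F
        simp only [potential, Prod.fst_add, Prod.snd_add, Submodule.coe_add, Pi.add_apply,
          add_mul, Finset.sum_add_distrib]
        ring
      map_smul' := by
        intro r x
        ext F
        simp only [potential, Prod.smul_fst, Prod.smul_snd, Submodule.coe_smul, Pi.smul_apply,
          smul_eq_mul, mul_assoc, ← Finset.mul_sum, RingHom.id_apply]
        ring }
  have hinj : Function.Injective Φ := by
    rw [injective_iff_map_eq_zero]
    rintro ⟨⟨z, hz⟩, c⟩ h0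
    have hval : ∀ F, D.potential z (pt F) + c = 0 := fun F => congrFun h0 F
    have hz0 : z = 0 := by
      ext e
      obtain ⟨F₁, F₂, hF₁, hF₂, -, -, -, hjump⟩ := D.exists_sides_potential e
      have h1 := hjump z hz _ (hpt ⟨F₁, hF₁⟩) _ (hpt ⟨F₂, hF₂⟩)
      have h2 := hval ⟨F₁, hF₁⟩
      have h3 := hval ⟨F₂, hF₂⟩
      have h4 : z e * (2 * Real.pi * Complex.I) = 0 := by
        rw [← h1]; linear_combination h2 - h3
      exact (mul_eq_zero.1 h4).resolve_right Complex.two_pi_I_ne_zero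
    obtain ⟨x, hx⟩ := D.dense_compl_support.nonempty
    obtain ⟨F, hF, -⟩ := exists_isFace_mem hx
    have hc := hval ⟨F, hF⟩
    subst hz0
    simp only [potential, Pi.zero_apply, zero_mul, Finset.sum_const_zero, zero_add] at hc
    subst hc
    rfl
  have h1 := LinearMap.finrank_le_finrank_of_injective hinj
  rw [Module.finrank_prod, Module.finrank_self, Module.finrank_fintype_fun_eq_card] at h1
  have h2 := LinearMap.finrank_range_add_finrank_ker (boundary (G := G))
  rw [Module.finrank_fintype_fun_eq_card] at h2
  have h3 := finrank_range_boundary_lt (G := G)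
  rw [Nat.card_eq_fintype_card]
  omega

end Potential

end PlaneDrawing

/-! ### Faces, dual connectivity and counting in a triangulation. -/

namespace PlaneDrawing

variable {V : Type*} {G : SimpleGraph V} (D : PlaneDrawing G)

/-- The edge `e` lies on the boundary of `F` (tested at one inner point of `e`). -/
def Borders (e : G.edgeSet) (F : Set Plane) : Prop := D.chart e 0 ∈ closure F

/-- The face `F` is bounded by the triangle `abc`. -/
structure IsBoundedBy (F : Set Plane) (a b c : V) : Prop where
  isFace : D.IsFace F
  adj₁ : G.Adj a b
  adj₂ : G.Adj b c
  adj₃ : G.Adj c a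
  frontier_eq : frontier F = D.arc s(a, b) ∪ D.arc s(b, c) ∪ D.arc s(c, a)

variable {D}

theorem IsBoundedBy.rot {F : Set Plane} {a b c : V} (h : D.IsBoundedBy F a b c) :
    D.IsBoundedBy F b c a :=
  ⟨h.isFace, h.adj₂, h.adj₃, h.adj₁, by
    rw [h.frontier_eq, Set.union_assoc, Set.union_comm]⟩

theorem IsBoundedBy.swap {F : Set Plane} {a b c : V} (h : D.IsBoundedBy F a b c) :
    D.IsBoundedBy F b a c :=
  ⟨h.isFace, h.adj₁.symm, h.adj₃.symm, h.adj₂.symm, by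
    rw [h.frontier_eq, Sym2.eq_swap (a := b) (b := a), Sym2.eq_swap (a := a) (b := c),
      Sym2.eq_swap (a := c) (b := b), Set.union_right_comm]⟩

theorem IsTriangulation.exists_isBoundedBy (hD : D.IsTriangulation) {F : Set Plane}
    (hF : D.IsFace F) : ∃ a b c, D.IsBoundedBy F a b c := by
  obtain ⟨-, a, b, c, h1, h2, h3, h4⟩ := hD F hF
  exact ⟨a, b, c, hF, h1, h2, h3, h4⟩

section

variable [Finite V]

theorem IsBoundedBy.eq_of_mem_arc {F : Set Plane} {a b c : V} (h : D.IsBoundedBy F a b c)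
    {e : G.edgeSet} {p : Plane} (hp : p ∈ D.arc e) (hv : p ∉ Set.range D.point)
    (hF : p ∈ closure F) :
    (e : Sym2 V) = s(a, b) ∨ (e : Sym2 V) = s(b, c) ∨ (e : Sym2 V) = s(c, a) := by
  have hf : p ∈ frontier F := by
    rw [h.isFace.frontier_eq]
    exact ⟨hF, D.arc_subset_support e.2 hp⟩
  rw [h.frontier_eq] at hf
  rcases hf with (hf | hf) | hf
  · exact Or.inl (D.eq_of_mem_arc_of_mem_arc e.2 h.adj₁ hp hf hv)
  · exact Or.inr (Or.inl (D.eq_of_mem_arc_of_mem_arc e.2 h.adj₂ hp hf hv))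
  · exact Or.inr (Or.inr (D.eq_of_mem_arc_of_mem_arc e.2 h.adj₃ hp hf hv))

theorem IsBoundedBy.borders_iff {F : Set Plane} {a b c : V} (h : D.IsBoundedBy F a b c)
    {e : G.edgeSet} : D.Borders e F ↔
      (e : Sym2 V) = s(a, b) ∨ (e : Sym2 V) = s(b, c) ∨ (e : Sym2 V) = s(c, a) := by
  refine ⟨h.eq_of_mem_arc (D.chart_zero_mem_arc e) (D.chart_zero_notMem_range e), fun he => ?_⟩
  apply frontier_subset_closure
  have := D.chart_zero_mem_arc e
  rw [h.frontier_eq]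
  rcases he with he | he | he <;> rw [he] at this
  · exact Or.inl (Or.inl this)
  · exact Or.inl (Or.inr this)
  · exact Or.inr this

theorem IsBoundedBy.third_eq {F : Set Plane} {a b c d : V} (h : D.IsBoundedBy F a b c)
    (h' : D.IsBoundedBy F a b d) : c = d := by
  have h1 : D.Borders ⟨s(b, d), h'.adj₂⟩ F := h'.borders_iff.2 (Or.inr (Or.inl rfl))
  have := h.borders_iff.1 h1
  simp only [Sym2.eq_iff] at this
  have := h'.adj₁.ne
  have := h'.adj₂.ne
  have := h'.adj₃.ne
  grind

variable (hD : D.IsTriangulation)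
include hD

theorem IsTriangulation.exists_isBoundedBy_of_borders {F : Set Plane} (hF : D.IsFace F) {a b : V}
    (hab : G.Adj a b) (he : D.Borders ⟨s(a, b), hab⟩ F) : ∃ c, D.IsBoundedBy F a b c := by
  obtain ⟨x, y, z, h⟩ := hD.exists_isBoundedBy hF
  have key : ∀ {x y z}, D.IsBoundedBy F x y z → s(a, b) = s(x, y) →
      ∃ c, D.IsBoundedBy F a b c := by
    intro x y z h hs
    rcases Sym2.eq_iff.1 hs with ⟨rfl, rfl⟩ | ⟨rfl, rfl⟩
    · exact ⟨z, h⟩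
    · exact ⟨z, h.swap⟩
  rcases h.borders_iff.1 he with he | he | he
  · exact key h he
  · exact key h.rot he
  · exact key h.rot.rot he

/-- The frontier of a face consists of whole edges, so any non-vertex point of an edge tests as well
as the midpoint. -/
theorem IsTriangulation.borders_of_mem {F : Set Plane} (hF : D.IsFace F) {e : G.edgeSet}
    {p : Plane} (hp : p ∈ D.arc e) (hv : p ∉ Set.range D.point) (hpF : p ∈ closure F) :
    D.Borders e F := by
  obtain ⟨a, b, c, h⟩ := hD.exists_isBoundedBy hF
  exact h.borders_iff.2 (h.eq_of_mem_arc hp hv hpF)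

theorem IsTriangulation.finite_faces : {F | D.IsFace F}.Finite := by
  have hsub : {F | D.IsFace F} ⊆ ⋃ e : G.edgeSet, {F | D.IsFace F ∧ D.Borders e F} := by
    intro F hF
    obtain ⟨a, b, c, h⟩ := hD.exists_isBoundedBy hF
    exact Set.mem_iUnion.2 ⟨⟨s(a, b), h.adj₁⟩, hF, h.borders_iff.2 (Or.inl rfl)⟩
  refine (Set.finite_iUnion fun e => ?_).subset hsub
  obtain ⟨_, -, F₁, F₂, -, -, -, -, -, -, h⟩ := D.exists_sides e
  exact (Set.toFinite {F₁, F₂}).subset fun F hF => h F hF.1 hF.2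

/-- The dual graph of a plane triangulation is connected. -/
theorem IsTriangulation.forall_mem_of_closed {A : Set (Set Plane)} {F₀ : Set Plane}
    (hF₀ : D.IsFace F₀) (hA₀ : F₀ ∈ A)
    (hA : ∀ F ∈ A, ∀ F', D.IsFace F → D.IsFace F' → ∀ e, D.Borders e F → D.Borders e F' → F' ∈ A)
    {F₁ : Set Plane} (hF₁ : D.IsFace F₁) : F₁ ∈ A := by
  by_contra hA₁
  have hfin := hD.finite_faces
  set S : Set Plane := (Set.range D.point)ᶜ with hS
  -- The plane minus the finitely many vertices is connected, so the closures of the faces in `A`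
  -- and of those outside `A` meet off the vertices. A common point lies on an edge bordering a face
  -- of either kind.
  have hSc : IsPreconnected S := by
    refine (Set.Countable.isConnected_compl_of_one_lt_rank ?_
      (Set.finite_range _).countable).isPreconnected
    rw [← Module.finrank_eq_rank, finrank_euclideanSpace_fin]
    norm_num
  have hpoint : Set.range D.point ⊆ D.support := Set.subset_union_left
  have hcl : ∀ B : Set (Set Plane), IsClosed (⋃ F ∈ {F | D.IsFace F} ∩ B, closure F) := fun B =>
    (hfin.subset Set.inter_subset_left).isClosed_biUnion fun _ _ => isClosed_closure
  have hmem : ∀ {B : Set (Set Plane)} {F : Set Plane}, D.IsFace F → F ∈ B →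
      (S ∩ ⋃ F ∈ {F | D.IsFace F} ∩ B, closure F).Nonempty := by
    intro B F hF hB
    obtain ⟨p, hp⟩ := hF.nonempty
    exact ⟨p, fun h => hF.subset hp (hpoint h),
      Set.mem_biUnion (⟨hF, hB⟩ : F ∈ {F | D.IsFace F} ∩ B) (subset_closure hp)⟩
  have hcover : (⋃ F ∈ {F | D.IsFace F} ∩ A, closure F) ∪
      (⋃ F ∈ {F | D.IsFace F} ∩ Aᶜ, closure F) = Set.univ := by
    rw [← ((hcl A).union (hcl Aᶜ)).closure_eq, ← dense_iff_closure_eq]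
    refine D.dense_compl_support.mono fun p hp => ?_
    obtain ⟨F, hF, hpF⟩ := exists_isFace_mem hp
    by_cases hFA : F ∈ A
    · exact Or.inl (Set.mem_biUnion (⟨hF, hFA⟩ : F ∈ {F | D.IsFace F} ∩ A) (subset_closure hpF))
    · exact Or.inr (Set.mem_biUnion (⟨hF, hFA⟩ : F ∈ {F | D.IsFace F} ∩ Aᶜ) (subset_closure hpF))
  obtain ⟨p, hpS, hp, hp'⟩ := isPreconnected_closed_iff.1 hSc _ _ (hcl A) (hcl Aᶜ)
    (hcover ▸ Set.subset_univ _) (hmem hF₀ hA₀) (hmem hF₁ hA₁)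
  obtain ⟨F, ⟨hF, hFA⟩, hpF⟩ := Set.mem_iUnion₂.1 hp
  obtain ⟨F', ⟨hF', hFA'⟩, hpF'⟩ := Set.mem_iUnion₂.1 hp'
  by_cases hs : p ∈ D.support
  · rcases hs with hs | hs
    · exact hpS hs
    · obtain ⟨e, he, hpe⟩ := Set.mem_iUnion₂.1 hs
      exact hFA' (hA F hFA F' hF hF' ⟨e, he⟩
        (hD.borders_of_mem hF (e := ⟨e, he⟩) hpe hpS hpF)
        (hD.borders_of_mem hF' (e := ⟨e, he⟩) hpe hpS hpF'))
  · have := hF.eq_of_mem hF' (hF.mem_of_mem_closure hpF hs) (hF'.mem_of_mem_closure hpF' hs)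
    exact hFA' (this ▸ hFA)

/-- Triangles of faces sharing an edge share vertices, so connectedness passes from the dual graph
to `G`. -/
theorem IsTriangulation.preconnected (hdeg : ∀ v, ∃ w, G.Adj v w) : G.Preconnected := by
  intro u v
  have bd : ∀ v, ∃ F a b, D.IsBoundedBy F v a b := by
    intro v
    obtain ⟨w, hw⟩ := hdeg v
    obtain ⟨_, -, F, -, hF, -, -, -, h, -⟩ := D.exists_sides ⟨s(v, w), hw⟩
    obtain ⟨c, hc⟩ := hD.exists_isBoundedBy_of_borders hF hw h
    exact ⟨F, w, c, hc⟩
  obtain ⟨F, a, b, hF⟩ := bd u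
  obtain ⟨F', a', b', hF'⟩ := bd v
  have reach : ∀ {F a b c} {e : G.edgeSet}, D.IsBoundedBy F a b c → D.Borders e F →
      G.Reachable a (tail e) := by
    intro F a b c e h he
    rcases h.borders_iff.1 he with he | he | he <;> rw [← mk_tail_head, Sym2.eq_iff] at he <;>
      rcases he with ⟨h1, -⟩ | ⟨h1, -⟩ <;> rw [h1]
    exacts [h.adj₁.reachable, h.adj₁.reachable, h.adj₃.symm.reachable, h.adj₃.symm.reachable]
  have := hD.forall_mem_of_closed (A := {F | ∀ a b c, D.IsBoundedBy F a b c → G.Reachable u a})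
    hF.isFace ?_ ?_ hF'.isFace
  · exact this v a' b' hF'
  · intro x y z h
    have h1 := hF.borders_iff (e := ⟨s(u, a), hF.adj₁⟩).2 (Or.inl rfl)
    exact (reach hF h1).trans (reach h h1).symm
  · intro F hF F' hf hf' e he he' x y z h
    obtain ⟨x', y', z', h'⟩ := hD.exists_isBoundedBy hf
    exact ((hF _ _ _ h').trans (reach h' he)).trans (reach h he').symm

/-- In a triangulation, the two sides of an edge are different faces. -/
theorem IsTriangulation.exists_two_faces (e : G.edgeSet) : ∃ F₁ F₂, F₁ ≠ F₂ ∧ D.IsFace F₁ ∧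
    D.IsFace F₂ ∧ D.Borders e F₁ ∧ D.Borders e F₂ ∧
    ∀ F, D.IsFace F → D.Borders e F → F = F₁ ∨ F = F₂ := by
  classical
  have := Fintype.ofFinite V
  have := Fintype.ofFinite G.edgeSet
  obtain ⟨F₁, F₂, hF₁, hF₂, h1, h2, hall, hjump⟩ := D.exists_sides_potential e
  refine ⟨F₁, F₂, ?_, hF₁, hF₂, h1, h2, hall⟩
  rintro rfl
  have hab := adj_tail_head e
  have he : e = ⟨s(tail e, head e), hab⟩ := Subtype.ext (mk_tail_head e).symm
  obtain ⟨c, hc⟩ := hD.exists_isBoundedBy_of_borders hF₁ hab (he ▸ h1)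
  obtain ⟨z, hz, hze⟩ := exists_cycle hc.adj₁ hc.adj₂ hc.adj₃ (mk_tail_head e).symm
  obtain ⟨p, hp⟩ := hF₁.nonempty
  have := hjump z hz p hp p hp
  rw [sub_self] at this
  exact mul_ne_zero hze Complex.two_pi_I_ne_zero this.symm

/-- If both faces at `ab` had the same third vertex, they would be bounded by one triangle, and dual
connectivity would make them the only faces. Every edge would then belong to that triangle; a third
neighbour of `a` prevents this. -/
theorem IsTriangulation.isTriangleSystem
    (hdeg : ∀ a b c, ∃ d, G.Adj a d ∧ d ≠ b ∧ d ≠ c) :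
    G.IsTriangleSystem fun a b c => ∃ F, D.IsBoundedBy F a b c where
  adj := fun ⟨_, h⟩ => h.adj₁
  swap := fun ⟨F, h⟩ => ⟨F, h.swap⟩
  rot := fun ⟨F, h⟩ => ⟨F, h.rot⟩
  exists_two := by
    intro a b hab
    obtain ⟨F₁, F₂, hne, hF₁, hF₂, h1, h2, hall⟩ := hD.exists_two_faces ⟨s(a, b), hab⟩
    obtain ⟨c, hc⟩ := hD.exists_isBoundedBy_of_borders hF₁ hab h1
    obtain ⟨d, hd⟩ := hD.exists_isBoundedBy_of_borders hF₂ hab h2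
    refine ⟨c, d, ?_, ⟨F₁, hc⟩, ⟨F₂, hd⟩, ?_⟩
    · rintro rfl
      have two : ∀ {e F}, D.Borders e F₁ → D.IsFace F → D.Borders e F → F = F₁ ∨ F = F₂ := by
        intro e F he hF heF
        obtain ⟨E₁, E₂, -, -, -, -, -, hall'⟩ := hD.exists_two_faces e
        have q1 := hall' _ hF₁ he
        have q2 := hall' _ hF₂ (hd.borders_iff.2 (hc.borders_iff.1 he))
        have q3 := hall' _ hF heF
        grind
      have all : ∀ F, D.IsFace F → F ∈ ({F₁, F₂} : Set (Set Plane)) := by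
        intro F hF
        refine hD.forall_mem_of_closed hF₁ (by simp) ?_ hF
        rintro F (rfl | rfl) F' hF hF' e he he'
        · exact two he hF' he'
        · exact two (hc.borders_iff.2 (hd.borders_iff.1 he)) hF' he'
      obtain ⟨x, hax, hxb, hxc⟩ := hdeg a b c
      obtain ⟨E, -, -, hE, -, hEb, -⟩ := hD.exists_two_faces ⟨s(a, x), hax⟩
      have hEe : s(a, x) = s(a, b) ∨ s(a, x) = s(b, c) ∨ s(a, x) = s(c, a) := by
        rcases all E hE with rfl | rfl
        · exact hc.borders_iff.1 hEb
        · exact hd.borders_iff.1 hEb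
      have n1 := hc.adj₁.ne
      have n2 := hc.adj₃.ne
      simp only [Sym2.eq_iff] at hEe
      grind
    · rintro x ⟨F, hF⟩
      rcases hall F hF.isFace (hF.borders_iff.2 (Or.inl rfl)) with rfl | rfl
      · exact Or.inl (hF.third_eq hc)
      · exact Or.inr (hF.third_eq hd)

theorem IsTriangulation.three_mul_card_faces_le [Fintype G.edgeSet] :
    Nat.card {F // D.IsFace F} * 3 ≤ Fintype.card G.edgeSet * 2 := by
  classical
  have : Finite {F // D.IsFace F} := hD.finite_faces
  have := Fintype.ofFinite {F // D.IsFace F}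
  rw [Nat.card_eq_fintype_card, ← Finset.card_univ, ← Finset.card_univ]
  refine Finset.card_mul_le_card_mul (fun F e => D.Borders e F.1) ?_ ?_
  · rintro ⟨F, hF⟩ -
    obtain ⟨a, b, c, h⟩ := hD.exists_isBoundedBy hF
    have n1 := h.adj₁.ne
    have n2 := h.adj₂.ne
    have n3 := h.adj₃.ne
    have h3 : Finset.card ({⟨s(a, b), h.adj₁⟩, ⟨s(b, c), h.adj₂⟩, ⟨s(c, a), h.adj₃⟩} :
        Finset G.edgeSet) = 3 := by
      refine Finset.card_eq_three.2 ⟨_, _, _, ?_, ?_, ?_, rfl⟩ <;>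
        intro h' <;> have h' := Sym2.eq_iff.1 (congrArg Subtype.val h') <;> grind
    rw [← h3]
    refine Finset.card_le_card fun e he => ?_
    simp only [Finset.mem_insert, Finset.mem_singleton] at he
    simp only [Finset.mem_bipartiteAbove, Finset.mem_univ, true_and]
    rw [h.borders_iff]
    rcases he with rfl | rfl | rfl <;> simp
  · rintro e -
    obtain ⟨F₁, F₂, -, hF₁, hF₂, -, -, hall⟩ := hD.exists_two_faces e
    refine (Finset.card_le_card (t := {⟨F₁, hF₁⟩, ⟨F₂, hF₂⟩}) ?_).trans Finset.card_le_two
    rintro ⟨F, hF⟩ hFe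
    simp only [Finset.mem_bipartiteBelow, Finset.mem_univ, true_and] at hFe
    rcases hall F hF hFe with rfl | rfl <;> simp

end

theorem IsTriangulation.card_edges_add_six_le [Fintype V] [Nonempty V] [Fintype G.edgeSet]
    (hD : D.IsTriangulation) : Fintype.card G.edgeSet + 6 ≤ 3 * Fintype.card V := by
  classical
  have h1 := D.card_edges_add_two_le hD.finite_faces
  have h2 := hD.three_mul_card_faces_le
  omega

end PlaneDrawing

/-! ### The classification. -/

theorem lemma2p3 {V : Type*} [Fintype V] (G : SimpleGraph V) [DecidableRel G.Adj]
    (D : PlaneDrawing G) (hD : D.IsTriangulation) :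
    (∃ k : ℕ, G.IsRegularOfDegree k) ↔
      Nonempty (G ≃g (⊤ : SimpleGraph (Fin 3))) ∨
      Nonempty (G ≃g (⊤ : SimpleGraph (Fin 4))) ∨
      Nonempty (G ≃g octahedronGraph) ∨
      Nonempty (G ≃g icosahedronGraph) := by
  classical
  constructor
  · rintro ⟨k, hk⟩
    obtain ⟨p, hp⟩ := D.dense_compl_support.nonempty
    obtain ⟨F, hF, -⟩ := PlaneDrawing.exists_isFace_mem hp
    obtain ⟨a, b, c, h⟩ := hD.exists_isBoundedBy hF
    have hV : Nonempty V := ⟨a⟩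
    have hk2 : 2 ≤ k := by
      rw [← hk a, ← SimpleGraph.card_neighborFinset_eq_degree,
        ← Finset.card_pair (a := b) (b := c) h.adj₂.ne]
      refine Finset.card_le_card fun x hx => ?_
      rw [SimpleGraph.mem_neighborFinset]
      simp only [Finset.mem_insert, Finset.mem_singleton] at hx
      rcases hx with rfl | rfl
      exacts [h.adj₁, h.adj₃.symm]
    have hG : G.Preconnected := hD.preconnected fun v =>
      (G.degree_pos_iff_exists_adj v).1 (by rw [hk v]; omega)
    -- Twice the bound E + 6 ≤ 3V, with 2E = kV by the handshake lemma. It gives k < 6, and for k =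
    -- 5 at least twelve vertices, which excludes K₆.
    have hcard : k * Fintype.card V + 12 ≤ 6 * Fintype.card V := by
      have h1 := hD.card_edges_add_six_le
      have h2 := G.sum_degrees_eq_twice_card_edges
      rw [Finset.sum_congr rfl fun v _ => hk v, Finset.sum_const, smul_eq_mul,
        Finset.card_univ, mul_comm, SimpleGraph.edgeFinset_card] at h2
      omega
    have hk6 : k < 6 := by
      by_contra hk6
      have := Nat.mul_le_mul_right (Fintype.card V) (not_lt.1 hk6)
      omega
    -- Degree two is a genuine exception: in K₃ both faces have the same triangle as boundary.
    have hT : 3 ≤ k → G.IsTriangleSystem fun a b c => ∃ F, D.IsBoundedBy F a b c := by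
      refine fun hk3 => hD.isTriangleSystem fun a b c => ?_
      obtain ⟨d, hd, hd'⟩ := Finset.exists_mem_notMem_of_card_lt_card
        (s := {b, c}) (t := G.neighborFinset a) (by
          rw [SimpleGraph.card_neighborFinset_eq_degree, hk a]
          exact Finset.card_le_two.trans_lt hk3)
      simp only [Finset.mem_insert, Finset.mem_singleton, not_or] at hd'
      exact ⟨d, (G.mem_neighborFinset _ _).1 hd, hd'⟩
    interval_cases k
    · left
      refine SimpleGraph.nonempty_iso_of_injective_hom hG hk (H := (⊤ : SimpleGraph (Fin 3)))
        (by have := SimpleGraph.IsRegularOfDegree.top (V := Fin 3); simpa using this)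
        ![a, b, c] ?_ ?_
      · have := h.adj₁.ne
        have := h.adj₂.ne
        have := h.adj₃.ne
        intro i j hij
        fin_cases i <;> fin_cases j <;> simp at hij ⊢ <;> grind
      · have h1 := h.adj₁
        have h2 := h.adj₂
        have h3 := h.adj₃
        intro i j hij
        fin_cases i <;> fin_cases j <;> simp at hij ⊢ <;>
          first | assumption | (apply SimpleGraph.Adj.symm; assumption)
    · exact Or.inr (Or.inl ((hT le_rfl).iso_top_four hG hk hV))
    · exact Or.inr (Or.inr (Or.inl ((hT (by norm_num)).iso_octahedronGraph hG hk hV)))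
    · exact Or.inr (Or.inr (Or.inr ((hT (by norm_num)).iso_icosahedronGraph hG hk hV
        (by omega))))
  · rintro (⟨⟨f⟩⟩ | ⟨⟨f⟩⟩ | ⟨⟨f⟩⟩ | ⟨⟨f⟩⟩)
    · exact ⟨_, SimpleGraph.IsRegularOfDegree.top.of_iso f⟩
    · exact ⟨_, SimpleGraph.IsRegularOfDegree.top.of_iso f⟩
    · exact ⟨_, octahedronGraph_isRegularOfDegree.of_iso f⟩
    · exact ⟨_, icosahedronGraph_isRegularOfDegree.of_iso f⟩
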